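/- Let $A$ be a closed, densely defined symmetric operator with finite equal deficiency indices in a complex Hilbert space $\mathcal H$. Let $\mathcal H_+=D(A^*)$ with inner product $(f,g)_+=(f,g)+(A^*f,A^*g)$, let $\mathcal H_-$ be the space of bounded conjugate-linear functionals on $\mathcal H_+$, so that $\mathcal H_+\subset\mathcal H\subset\mathcal H_-$, and write $[X,Y]$ for the bounded linear operators from $X$ to $Y$. For $\mathbb B\in[\mathcal H_+,\mathcal H_-]$ the adjoint $\mathbb B^*\in[\mathcal H_+,\mathcal H_-]$ is given by $(\mathbb B^*f,g)=(f,\mathbb Bg)$, and $\mathrm{Re}\,\mathbb B=\frac12(\mathbb B+\mathbb B^*)$, $\mathrm{Im}\,\mathbb B=\frac1{2i}(\mathbb B-\mathbb B^*)$. Let $T$ be an operator in $\mathcal H$ with non-empty set $\rho(T)$ of regular points and $D(A)=D(T)\cap D(T^*)$, and let $\mathbb A\in[\mathcal H_+,\mathcal H_-]$ be a $(*)$-extension of $T$: $\mathbb A\supset T\supset A$, $\mathbb A^*\supset T^*\supset A$, and $\mathrm{Re}\,\mathbb A$ is a self-adjoint bi-extension of $A$, i.e. $\mathrm{Re}\,\mathbb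 A\supset A$ and the operator $f\mapsto(\mathrm{Re}\,\mathbb A)f$ with domain $\{f\in\mathcal H_+:(\mathrm{Re}\,\mathbb A)f\in\mathcal H\}$ is self-adjoint in $\mathcal H$. Let $E$ be a finite-dimensional Hilbert space, $J\in[E,E]$ with $J=J^*=J^{-1}$, and $K\in[E,\mathcal H_-]$ with adjoint $K^*\in[\mathcal H_+,E]$, such that $\mathrm{Im}\,\mathbb A=KJK^*$. These data form a rigged canonical system $\Theta$ of the Livsic type. Assume that $\Theta$ is prime: the closed linear span of the subspaces $\mathfrak N_\lambda=\ker(A^*-\lambda I)$, over the non-real $\lambda\in\rho(T)$, is $\mathcal H$. Assume also that $\mathrm{Ran}\,K\subset\mathrm{Ran}(\mathrm{Im}\,\mathbb A)+\mathcal H$ (which holds automatically if $J=I$ or if $K$ is injective). Then for every non-real $z$ the operator $\mathrm{Re}\,\mathbb A-zI:\mathcal H_+\to\mathcal H_-$ is injective with range containing $\mathrm{Ran}\,K$, so that $$V_\Theta(z)=K^*(\mathrm{Re}\,\mathbb A-zI)^{-1}K\in[E,E]$$ is well defined, and $V_\Theta$ is a Stieltjes function if and only if $\mathbb A$ is accretive,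 i.e. $\mathrm{Re}\,(\mathbb Af,f)\ge0$ for all $f\in\mathcal H_+$. Here a function $V:\mathbb C\setminus\mathbb R\to[E,E]$ is a Stieltjes function if it is a Herglotz–Nevanlinna function (holomorphic on $\mathbb C\setminus\mathbb R$, $V(z)^*=V(\bar z)$, and $\mathrm{Im}\,V(z)\ge0$ for $\mathrm{Im}\,z>0$) that admits a representation $$V(z)=\gamma+\int_0^\infty\frac{dG(t)}{t-z},\qquad z\in\mathbb C\setminus\mathbb R,$$ with $\gamma\ge0$ and a non-decreasing operator-valued function $G$ on $[0,\infty)$ such that $\int_0^\infty\frac{(dG(t)e,e)_E}{1+t}<\infty$ for all $e\in E$. -/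

import Mathlib

open scoped InnerProductSpace LinearPMap ComplexConjugate

/- Over `ℂ`, let `inner` be found through `InnerProductSpace` and not through `CStarModule` (the
two are definitionally equal). -/
attribute [local instance 2000] InnerProductSpace.toInner

noncomputable section

namespace RiggedSystem

section Triplet

variable {H : Type*} [NormedAddCommGroup H] [InnerProductSpace ℂ H] [CompleteSpace H]

/-- The space `H₊ = D(A*)`. It is a separate type (not a subtype of `H` as far as instances are
concerned), since it carries the norm of the graph of `A*`. -/
def HPlus (A : H →ₗ.[ℂ] H) : Type _ := A†.domain

variable (A : H →ₗ.[ℂ] H)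

/-- The inner product `(f, g)₊ = (f, g) + (A* f, A* g)` on `D(A*)`. -/
abbrev HPlus.core : InnerProductSpace.Core ℂ A†.domain where
  inner f g := ⟪(f : H), (g : H)⟫_ℂ + ⟪A† f, A† g⟫_ℂ
  conj_inner_symm f g := by simp [inner_conj_symm]
  re_inner_nonneg f := by
    have h1 := inner_self_nonneg (𝕜 := ℂ) (x := (f : H))
    have h2 := inner_self_nonneg (𝕜 := ℂ) (x := A† f)
    simpa only [map_add] using add_nonneg h1 h2
  add_left f g h := by
    simp only [LinearPMap.map_add, Submodule.coe_add, inner_add_left]; ring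
  smul_left f g c := by
    simp only [LinearPMap.map_smul, Submodule.coe_smul, inner_smul_left]; ring
  definite f hf := by
    have h1 := inner_self_nonneg (𝕜 := ℂ) (x := (f : H))
    have h2 := inner_self_nonneg (𝕜 := ℂ) (x := A† f)
    have h3 := congrArg (RCLike.re (K := ℂ)) hf
    simp only [map_add, map_zero] at h3
    have h4 : RCLike.re ⟪(f : H), (f : H)⟫_ℂ = 0 := by linarith
    exact Subtype.ext (re_inner_self_nonpos.mp h4.le)

instance : NormedAddCommGroup (HPlus A) := (HPlus.core A).toNormedAddCommGroup

instance : InnerProductSpace ℂ (HPlus A) := InnerProductSpace.ofCore (HPlus.core A).toCore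

/-- The inclusion `H₊ ⊂ H`. -/
def HPlus.incl : HPlus A →ₗ[ℂ] H where
  toFun f := (show A†.domain from f).1
  map_add' _ _ := rfl
  map_smul' _ _ := rfl

/-- The operator `A*`, as a linear map on `H₊`. -/
def HPlus.star : HPlus A →ₗ[ℂ] H where
  toFun f := A† (show A†.domain from f)
  map_add' f g := A†.toFun.map_add f g
  map_smul' c f := A†.toFun.map_smul c f

theorem HPlus.inner_def (f g : HPlus A) :
    ⟪f, g⟫_ℂ = ⟪HPlus.incl A f, HPlus.incl A g⟫_ℂ + ⟪HPlus.star A f, HPlus.star A g⟫_ℂ := rfl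

theorem HPlus.norm_incl_le (f : HPlus A) : ‖HPlus.incl A f‖ ≤ 1 * ‖f‖ := by
  have h0 : ‖f‖ ^ 2 = ‖HPlus.incl A f‖ ^ 2 + ‖HPlus.star A f‖ ^ 2 := by
    rw [← inner_self_eq_norm_sq (𝕜 := ℂ) f, HPlus.inner_def, map_add,
      inner_self_eq_norm_sq, inner_self_eq_norm_sq]
  rw [one_mul]
  exact le_of_sq_le_sq (by nlinarith [sq_nonneg ‖HPlus.star A f‖]) (norm_nonneg _)

/-- The bounded inclusion `H₊ ⊂ H`. -/
def HPlus.inclL : HPlus A →L[ℂ] H := (HPlus.incl A).mkContinuous 1 (HPlus.norm_incl_le A)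

/-- The space `H₋`: bounded conjugate-linear functionals on `H₊`. For `φ ∈ H₋` and `f ∈ H₊` the
value `φ f` is the pairing `(φ, f)`, linear in `φ` and conjugate-linear in `f`. -/
abbrev HMinus : Type _ := HPlus A →L⋆[ℂ] ℂ

/-- The inclusion `H ⊂ H₋`, where `h` acts by `f ↦ (h, f)`. -/
def HMinus.ofH : H →L[ℂ] HMinus A :=
  ((innerSL ℂ : H →L⋆[ℂ] H →L[ℂ] ℂ).comp (HPlus.inclL A)).flip

theorem HMinus.ofH_apply (h : H) (f : HPlus A) : HMinus.ofH A h f = ⟪HPlus.incl A f, h⟫_ℂ := rfl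

variable {A}

/-- The adjoint `B* ∈ [H₊, H₋]` of `B ∈ [H₊, H₋]`: `(B* f, g) = (f, B g)`, where `(f, φ)` is the
conjugate of `(φ, f)`. -/
def adj (B : HPlus A →L[ℂ] HMinus A) : HPlus A →L[ℂ] HMinus A :=
  LinearMap.mkContinuous₂
    (LinearMap.mk₂'ₛₗ (RingHom.id ℂ) (starRingEnd ℂ) (fun f g => conj (B g f))
      (by intros; simp) (by intros; simp) (by intros; simp) (by intros; simp))
    ‖B‖ (by
      intro f g
      have := B.le_opNorm₂ g f
      simp only [LinearMap.mk₂'ₛₗ_apply, RCLike.norm_conj]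
      linarith [mul_right_comm ‖B‖ ‖f‖ ‖g‖])

theorem adj_apply (B : HPlus A →L[ℂ] HMinus A) (f g : HPlus A) : adj B f g = conj (B g f) := rfl

/-- The real part `(B + B*) / 2`. -/
def rePart (B : HPlus A →L[ℂ] HMinus A) : HPlus A →L[ℂ] HMinus A := (1 / 2 : ℂ) • (B + adj B)

/-- The imaginary part `(B - B*) / (2i)`. -/
def imPart (B : HPlus A →L[ℂ] HMinus A) : HPlus A →L[ℂ] HMinus A :=
  (1 / (2 * Complex.I) : ℂ) • (B - adj B)

/-- `B ⊃ S` for `B ∈ [H₊, H₋]` and an operator `S` in `H`: `D(S) ⊂ H₊` and `B f = S f` for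
`f ∈ D(S)`. -/
def Extends (B : HPlus A →L[ℂ] HMinus A) (S : H →ₗ.[ℂ] H) : Prop :=
  ∀ s : S.domain, ∃ f : HPlus A, HPlus.incl A f = s ∧ B f = HMinus.ofH A (S s)

/-- The quasi-kernel of `B ∈ [H₊, H₋]`: the operator `f ↦ B f` in `H` with domain
`{f ∈ H₊ : B f ∈ H}`, given here by its graph (a graph as soon as `D(A*)` is dense in `H`). -/
def quasiKernel (B : HPlus A →L[ℂ] HMinus A) : H →ₗ.[ℂ] H :=
  Submodule.toLinearPMap
    { carrier := {p | ∃ f : HPlus A, HPlus.incl A f = p.1 ∧ B f = HMinus.ofH A p.2}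
      add_mem' := by
        rintro p q ⟨f, hf, hf'⟩ ⟨g, hg, hg'⟩
        exact ⟨f + g, by simp [hf, hg], by simp [hf', hg']⟩
      zero_mem' := ⟨0, by simp, by simp⟩
      smul_mem' := by
        rintro c p ⟨f, hf, hf'⟩
        exact ⟨c • f, by simp [hf], by simp [hf']⟩ }

/-- Self-adjoint bi-extensions of the symmetric operator `A`. -/
structure IsSelfAdjointBiExtension (B : HPlus A →L[ℂ] HMinus A) : Prop where
  adj_eq : adj B = B
  extends_base : Extends B A
  isSelfAdjoint_quasiKernel : IsSelfAdjoint (quasiKernel B)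

/-- `z` is a regular point of `T`: `T - z I` maps `D(T)` bijectively onto `H`, with a bounded
inverse. -/
def IsRegularPoint (T : H →ₗ.[ℂ] H) (z : ℂ) : Prop :=
  ∃ R : H →L[ℂ] H,
    (∀ h : H, ∃ f : T.domain, (f : H) = R h ∧ T f - z • (f : H) = h) ∧
    ∀ f : T.domain, R (T f - z • (f : H)) = f

/-- `(*)`-extensions `B` of an operator `T` with `ρ(T) ≠ ∅`: `B ⊃ T ⊃ A`, `B* ⊃ T* ⊃ A` and
the real part of `B` is a self-adjoint bi-extension of `A`. -/
structure IsStarExtension (B : HPlus A →L[ℂ] HMinus A) (T : H →ₗ.[ℂ] H) : Prop where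
  exists_regularPoint : ∃ z, IsRegularPoint T z
  le_T : A ≤ T
  le_T_adjoint : A ≤ T†
  extends_T : Extends B T
  adj_extends_T_adjoint : Extends (adj B) T†
  rePart_biExtension : IsSelfAdjointBiExtension (rePart B)

/-- `B ∈ [H₊, H₋]` is accretive: `Re (B f, f) ≥ 0` for all `f ∈ H₊`. -/
def IsAccretive (B : HPlus A →L[ℂ] HMinus A) : Prop := ∀ f : HPlus A, 0 ≤ (B f f).re

variable (A) in
/-- The defect subspace `𝔑_z = ker (A* - z I)`, as a subspace of `H`. -/
def defect (z : ℂ) : Submodule ℂ H :=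
  (LinearMap.ker (HPlus.star A - z • HPlus.incl A)).map (HPlus.incl A)

end Triplet

section System

variable {H : Type*} [NormedAddCommGroup H] [InnerProductSpace ℂ H] [CompleteSpace H]
variable {E : Type*} [NormedAddCommGroup E] [InnerProductSpace ℂ E] [FiniteDimensional ℂ E]

/-- The adjoint `K* ∈ [H₊, E]` of `K ∈ [E, H₋]`: `(K* f, e)_E = (f, K e)`. -/
def channelAdj {A : H →ₗ.[ℂ] H} (K : E →L[ℂ] HMinus A) : HPlus A →L[ℂ] E :=
  haveI : CompleteSpace E := FiniteDimensional.complete ℂ E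
  ((InnerProductSpace.toDual ℂ E).symm.toContinuousLinearEquiv :
    (E →L[ℂ] ℂ) →L⋆[ℂ] E).comp K.flip

theorem inner_channelAdj {A : H →ₗ.[ℂ] H} (K : E →L[ℂ] HMinus A) (f : HPlus A) (e : E) :
    ⟪e, channelAdj K f⟫_ℂ = conj (K e f) := by
  have : CompleteSpace E := FiniteDimensional.complete ℂ E
  rw [← inner_conj_symm]
  congr 1
  exact InnerProductSpace.toDual_symm_apply

end System

end RiggedSystem

open RiggedSystem

/-- A rigged canonical system of the Livsic type with state space `H` and input-output space `E`:
the array `(𝔸, K, J; H₊ ⊂ H ⊂ H₋, E)`, together with the closed densely defined symmetric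
operator `A` (of finite equal deficiency indices) that determines the triplet, and the operator `T`
of which `𝔸` is a `(*)`-extension. -/
structure RiggedCanonicalSystem (H E : Type*)
    [NormedAddCommGroup H] [InnerProductSpace ℂ H] [CompleteSpace H]
    [NormedAddCommGroup E] [InnerProductSpace ℂ E] [FiniteDimensional ℂ E] where
  /-- the symmetric operator -/
  A : H →ₗ.[ℂ] H
  isClosed_A : A.IsClosed
  dense_A : Dense (A.domain : Set H)
  symmetric_A : A.IsFormalAdjoint A
  finite_defect : FiniteDimensional ℂ (defect A Complex.I)
  finite_defect' : FiniteDimensional ℂ (defect A (-Complex.I))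
  defect_eq :
    Module.finrank ℂ (defect A Complex.I) = Module.finrank ℂ (defect A (-Complex.I))
  /-- the operator `T`, with `A ⊂ T ⊂ A*` -/
  T : H →ₗ.[ℂ] H
  domain_A : A.domain = T.domain ⊓ T†.domain
  /-- the main operator -/
  main : HPlus A →L[ℂ] HMinus A
  isStarExtension : IsStarExtension main T
  /-- the direction operator -/
  J : E →L[ℂ] E
  J_selfAdjoint : ∀ x y : E, ⟪J x, y⟫_ℂ = ⟪x, J y⟫_ℂ
  J_involutive : ∀ x : E, J (J x) = x
  /-- the channel operator -/
  K : E →L[ℂ] HMinus A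
  imPart_main : imPart main = K.comp (J.comp (channelAdj K))

namespace RiggedCanonicalSystem

variable {H E : Type*}
  [NormedAddCommGroup H] [InnerProductSpace ℂ H] [CompleteSpace H]
  [NormedAddCommGroup E] [InnerProductSpace ℂ E] [FiniteDimensional ℂ E]

/-- The system is prime: the closed linear span of the defect subspaces `𝔑_z`, over the non-real
regular points `z` of `T`, is `H`. -/
def IsPrime (Θ : RiggedCanonicalSystem H E) : Prop :=
  (⨆ z ∈ {z : ℂ | z.im ≠ 0 ∧ IsRegularPoint Θ.T z}, defect Θ.A z).topologicalClosure = ⊤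

/-- The operator `Re 𝔸 - z I ∈ [H₊, H₋]`. -/
def shifted (Θ : RiggedCanonicalSystem H E) (z : ℂ) : HPlus Θ.A →L[ℂ] HMinus Θ.A :=
  rePart Θ.main - z • (HMinus.ofH Θ.A).comp (HPlus.inclL Θ.A)

/-- The expression `K* (Re 𝔸 - z I)⁻¹ K` makes sense at `z`: the operator `Re 𝔸 - z I` is
injective and its range contains that of `K`. -/
def IsDefinedAt (Θ : RiggedCanonicalSystem H E) (z : ℂ) : Prop :=
  Function.Injective (Θ.shifted z) ∧ ∀ e : E, ∃ f : HPlus Θ.A, Θ.shifted z f = Θ.K e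

/-- `(Re 𝔸 - z I)⁻¹ K` as a linear map from `E` to `H₊`, at a point where it makes sense. -/
def invK (Θ : RiggedCanonicalSystem H E) {z : ℂ} (h : Θ.IsDefinedAt z) : E →ₗ[ℂ] HPlus Θ.A :=
  (LinearEquiv.ofInjective (Θ.shifted z).toLinearMap h.1).symm.toLinearMap.comp
    (LinearMap.codRestrict (LinearMap.range (Θ.shifted z).toLinearMap) Θ.K.toLinearMap
      (fun e => h.2 e))

theorem shifted_invK (Θ : RiggedCanonicalSystem H E) {z : ℂ} (h : Θ.IsDefinedAt z) (e : E) :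
    Θ.shifted z (Θ.invK h e) = Θ.K e :=
  congrArg Subtype.val ((LinearEquiv.ofInjective (Θ.shifted z).toLinearMap h.1).apply_symm_apply
    (LinearMap.codRestrict (LinearMap.range (Θ.shifted z).toLinearMap) Θ.K.toLinearMap
      (fun e => h.2 e) e))

open Classical in
/-- The function `V_Θ(z) = K* (Re 𝔸 - z I)⁻¹ K` (with value `0` where this makes no sense). -/
def V (Θ : RiggedCanonicalSystem H E) (z : ℂ) : E →L[ℂ] E :=
  if h : Θ.IsDefinedAt z then
    LinearMap.toContinuousLinearMap ((channelAdj Θ.K).toLinearMap.comp (Θ.invK h))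
  else 0

end RiggedCanonicalSystem

section Stieltjes

variable {E : Type*} [NormedAddCommGroup E] [InnerProductSpace ℂ E]

/-- Operator-valued Herglotz-Nevanlinna functions on `ℂ \ ℝ`. -/
structure IsHerglotzNevanlinna (V : ℂ → E →L[ℂ] E) : Prop where
  differentiableOn : DifferentiableOn ℂ V {z | z.im ≠ 0}
  symm : ∀ z : ℂ, z.im ≠ 0 → ∀ x y : E, ⟪V z x, y⟫_ℂ = ⟪x, V (conj z) y⟫_ℂ
  im_nonneg : ∀ z : ℂ, 0 < z.im → ∀ e : E, 0 ≤ (⟪e, V z e⟫_ℂ).im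

/-- `G` is non-decreasing on `[0, ∞)`. -/
def NondecreasingOp (G : ℝ → E →L[ℂ] E) : Prop :=
  ∀ s t : ℝ, 0 ≤ s → s ≤ t → (G t - G s).IsPositive

theorem NondecreasingOp.monotone {G : ℝ → E →L[ℂ] E} (hG : NondecreasingOp G) (e : E) :
    Monotone fun t : ℝ => (⟪e, G (max t 0) e⟫_ℂ).re := by
  intro s t hst
  have h := (hG (max s 0) (max t 0) (le_max_right _ _) (max_le_max_right 0 hst)).re_inner_nonneg_right e
  rw [sub_apply, inner_sub_right, map_sub] at h
  simpa using sub_nonneg.mp h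

/-- The measure `(dG(t) e, e)` on `[0, ∞)`, as a measure on `ℝ`. The function `t ↦ (G(t) e, e)` is
extended to `t < 0` by its value at `0`, so that a jump `G(0+) - G(0)` gives mass to `{0}`, as it
does in the Riemann-Stieltjes integral over `[0, ∞)`. -/
def NondecreasingOp.measure {G : ℝ → E →L[ℂ] E} (hG : NondecreasingOp G) (e : E) :
    MeasureTheory.Measure ℝ :=
  (hG.monotone e).stieltjesFunction.measure

/-- Operator-valued Stieltjes functions: Herglotz-Nevanlinna functions of the form
`V(z) = γ + ∫₀^∞ dG(t) / (t - z)` with `γ ≥ 0`, `G` non-decreasing on `[0, ∞)`, and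
`∫₀^∞ (dG(t) e, e) / (1 + t) < ∞` for all `e`. The operator integral is understood through its
quadratic form. -/
def IsStieltjes (V : ℂ → E →L[ℂ] E) : Prop :=
  IsHerglotzNevanlinna V ∧
  ∃ (γ : E →L[ℂ] E) (G : ℝ → E →L[ℂ] E) (hG : NondecreasingOp G),
    γ.IsPositive ∧
    (∀ e : E, MeasureTheory.IntegrableOn (fun t : ℝ => 1 / (1 + t)) (Set.Ici 0) (hG.measure e)) ∧
    ∀ z : ℂ, z.im ≠ 0 → ∀ e : E,
      ⟪e, V z e⟫_ℂ = ⟪e, γ e⟫_ℂ + ∫ t in Set.Ici (0 : ℝ), 1 / ((t : ℂ) - z) ∂(hG.measure e)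

end Stieltjes

end

/-! Subtract `A*`: `Re 𝔸 - z` is `boundaryPart` plus `A* - z`, the latter with values in `H`. On
`D(T)` the imaginary part of `𝔸` is `i` times `boundaryPart`, on `D(T*)` it is `-i` times it, and
`D(T) + D(T*)` is dense in `H₊`; as the ranges are finite-dimensional, they coincide
(`range_boundaryPart`). The restriction of `A*` to `{f : (Re 𝔸) f = A* f}` is the self-adjoint
quasi-kernel, and its resolvent solves `(Re 𝔸 - z) f = h` for `h ∈ H`. So the range of `Re 𝔸 - z`
contains `Ran (Im 𝔸) + H`, hence `Ran K`.

Accretive implies Stieltjes. The point `-1` is now regular for the quasi-kernel, with resolvent `0 ≤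
C ≤ 1`. With `F = (Re 𝔸 + I)⁻¹ K` viewed in `H`, the resolvent identity gives `V(z) = V(-1) + (z +
1) F* (1 - (z + 1) C)⁻¹ F`. Cauchy-Schwarz for the form of `Re 𝔸 + I` yields `|(k, F e)|² ≤ (C k, k)
(V(-1) e, e)`, which forces `∫ s⁻¹ dν ≤ (V(-1) e, e)` for the spectral measure `ν` of `C` at `F e`.
The substitution `t = s⁻¹ - 1` turns the formula for `V` into a Stieltjes representation, and the
surplus in that inequality is `γ` (`exists_stieltjes_representation`).

Stieltjes implies accretive. The integral representation makes the kernel `(z V(z) - w̄ V(w)*) / (z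
- w̄)` non-negative (`IsStieltjes.kernelNonneg`). If `u ∈ 𝔑_z` and `v ∈ 𝔑_w`, then `(Re 𝔸 - z) u = K
e` and `(Re 𝔸 - w) v = K e'` for some `e`, `e'`, and `(Re 𝔸 u, v)` is exactly this kernel at `e`,
`e'` (`rePart_apply_eq_kernel`). So the form of `Re 𝔸` is non-negative on spans of defect vectors,
and primeness makes these dense in `H₊` (`defectSpan_closure_eq_top`). -/

open MeasureTheory Filter Topology Set CompactlySupported

/-! ### Polarization and limits of quadratic forms. -/

section QuadraticLimits

variable {E : Type*} [NormedAddCommGroup E] [InnerProductSpace ℂ E]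

theorem inner_map_eq_quadratic (M : E →L[ℂ] E) (x y : E) :
    ⟪x, M y⟫_ℂ = (⟪x + y, M (x + y)⟫_ℂ - ⟪x - y, M (x - y)⟫_ℂ
      - Complex.I * ⟪x + Complex.I • y, M (x + Complex.I • y)⟫_ℂ
      + Complex.I * ⟪x - Complex.I • y, M (x - Complex.I • y)⟫_ℂ) / 4 := by
  simp only [map_add, map_sub, map_smul, inner_add_left, inner_add_right, inner_sub_left,
    inner_sub_right, inner_smul_left, inner_smul_right, Complex.conj_I]
  ring_nf
  simp only [Complex.I_sq]
  ring

theorem tendsto_inner_map_of_quadratic {α : Type*} {l : Filter α} {M : α → E →L[ℂ] E}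
    {N : E →L[ℂ] E} (h : ∀ e, Tendsto (fun a => ⟪e, M a e⟫_ℂ) l (𝓝 ⟪e, N e⟫_ℂ)) (x y : E) :
    Tendsto (fun a => ⟪x, M a y⟫_ℂ) l (𝓝 ⟪x, N y⟫_ℂ) := by
  simp only [inner_map_eq_quadratic _ x y]
  exact ((((h _).sub (h _)).sub ((h _).const_mul _)).add ((h _).const_mul _)).div_const _

/-- In finite dimension, a pointwise limit of quadratic forms of operators is the quadratic form
of an operator. -/
theorem exists_quadratic_limit [FiniteDimensional ℂ E] {α : Type*} {l : Filter α} [l.NeBot]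
    {M : α → E →L[ℂ] E} {c : E → ℂ} (h : ∀ e, Tendsto (fun a => ⟪e, M a e⟫_ℂ) l (𝓝 (c e))) :
    ∃ N : E →L[ℂ] E, ∀ e, ⟪e, N e⟫_ℂ = c e := by
  have h2 : ∀ x y, ∃ d, Tendsto (fun a => ⟪x, M a y⟫_ℂ) l (𝓝 d) := fun x y => by
    simp only [inner_map_eq_quadratic _ x y]
    exact ⟨_, ((((h _).sub (h _)).sub ((h _).const_mul _)).add ((h _).const_mul _)).div_const _⟩
  choose d hd using h2
  let b := stdOrthonormalBasis ℂ E
  have h3 : Tendsto (fun a x => (M a : E →ₗ[ℂ] E) x) l (𝓝 fun y => ∑ i, d (b i) y • b i) := by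
    rw [tendsto_pi_nhds]
    intro y
    have : (fun a => (M a : E →ₗ[ℂ] E) y) = fun a => ∑ i, ⟪b i, M a y⟫_ℂ • b i := by
      ext1 a
      exact (b.sum_repr' _).symm
    rw [this]
    exact tendsto_finsetSum _ fun i _ => (hd _ _).smul_const _
  refine ⟨LinearMap.toContinuousLinearMap (linearMapOfTendsto _ _ h3), fun e => ?_⟩
  refine tendsto_nhds_unique ?_ (h e)
  have := (tendsto_pi_nhds.1 h3 e)
  exact (tendsto_const_nhds (x := e)).inner this

end QuadraticLimits

/-! ### Spectral measures from the Riesz-Markov-Kakutani theorem. -/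

section SpectralMeasure

variable {H : Type*} [NormedAddCommGroup H] [InnerProductSpace ℂ H] [CompleteSpace H]

/-- The spectral measure of a bounded self-adjoint operator at a vector. -/
theorem exists_spectral_measure {C : H →L[ℂ] H} (hC : IsSelfAdjoint C) (x : H) :
    ∃ ν : Measure ℝ, IsFiniteMeasure ν ∧ (∀ᵐ s ∂ν, s ∈ spectrum ℝ C) ∧
      ∀ φ : ℝ → ℝ, ContinuousOn φ (spectrum ℝ C) →
        Integrable φ ν ∧ ⟪x, cfc φ C x⟫_ℂ = ∫ s, φ s ∂ν := by
  have hcomp : CompactSpace (spectrum ℝ C) := isCompact_iff_compactSpace.1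
    (ContinuousFunctionalCalculus.isCompact_spectrum C)
  have hsa : ∀ φ : C(spectrum ℝ C, ℝ), IsSelfAdjoint (cfcHom hC φ) := fun φ => by
    rw [IsSelfAdjoint, ← map_star]
    congr 1
  have him : ∀ φ : C(spectrum ℝ C, ℝ), ⟪x, cfcHom hC φ x⟫_ℂ = (⟪x, cfcHom hC φ x⟫_ℂ).re := by
    intro φ
    exact ((hsa φ).isSymmetric.coe_re_inner_self_apply x).symm
  let Λ₀ : C_c(spectrum ℝ C, ℝ) →ₗ[ℝ] ℝ :=
    { toFun := fun φ => (⟪x, cfcHom hC φ.toContinuousMap x⟫_ℂ).re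
      map_add' := fun φ ψ => by
        have : (φ + ψ).toContinuousMap = φ.toContinuousMap + ψ.toContinuousMap := rfl
        rw [this, map_add]
        simp [inner_add_right]
      map_smul' := fun c φ => by
        have : (c • φ).toContinuousMap = c • φ.toContinuousMap := rfl
        rw [this, map_smul]
        simp only [smul_apply, RingHom.id_apply, smul_eq_mul]
        rw [← Complex.coe_smul, inner_smul_right, Complex.re_ofReal_mul] }
  let Λ : C_c(spectrum ℝ C, ℝ) →ₚ[ℝ] ℝ := PositiveLinearMap.mk₀ Λ₀ fun φ hφ => by
    have h1 : 0 ≤ cfcHom hC φ.toContinuousMap := (cfcHom_nonneg_iff hC).2 fun s => hφ s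
    exact ((ContinuousLinearMap.nonneg_iff_isPositive _).1 h1).re_inner_nonneg_right x
  let ν₀ := RealRMK.rieszMeasure Λ
  have hemb : MeasurableEmbedding (Subtype.val : spectrum ℝ C → ℝ) :=
    MeasurableEmbedding.subtype_coe
      (ContinuousFunctionalCalculus.isCompact_spectrum C).isClosed.measurableSet
  have hfin : IsFiniteMeasure ν₀ := CompactSpace.isFiniteMeasure
  refine ⟨ν₀.map Subtype.val, Measure.isFiniteMeasure_map _ _, ?_, fun φ hφ => ?_⟩
  · exact hemb.ae_map_iff.2 (Eventually.of_forall fun s => s.2)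
  · have hφ' : Continuous fun s : spectrum ℝ C => φ s := hφ.domRestrict
    have hint : Integrable (fun s : spectrum ℝ C => φ s) ν₀ :=
      hφ'.integrable_of_hasCompactSupport (HasCompactSupport.of_compactSpace _)
    refine ⟨(hemb.integrable_map_iff).2 hint, ?_⟩
    rw [hemb.integral_map, cfc_apply φ C, him]
    have := RealRMK.integral_rieszMeasure Λ
      (CompactlySupportedContinuousMap.continuousMapEquiv ⟨fun s : spectrum ℝ C => φ s, hφ'⟩)
    exact congrArg _ this.symm

end SpectralMeasure

/-! ### Resolvents through the real functional calculus. -/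

section CfcResolvent

variable {H : Type*} [NormedAddCommGroup H] [InnerProductSpace ℂ H] [CompleteSpace H]

theorem cfc_apply_cfc_apply {C : H →L[ℂ] H} {φ ψ : ℝ → ℝ}
    (hφ : ContinuousOn φ (spectrum ℝ C)) (hψ : ContinuousOn ψ (spectrum ℝ C)) (x : H) :
    cfc φ C (cfc ψ C x) = cfc (fun s => φ s * ψ s) C x := by
  rw [cfc_mul φ ψ C hφ hψ]
  rfl

theorem apply_cfc_apply {C : H →L[ℂ] H} (hC : IsSelfAdjoint C) {ψ : ℝ → ℝ}
    (hψ : ContinuousOn ψ (spectrum ℝ C)) (x : H) :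
    C (cfc ψ C x) = cfc (fun s => s * ψ s) C x := by
  have h := cfc_apply_cfc_apply (φ := fun s => s) continuousOn_id hψ x
  rwa [cfc_id' ℝ C] at h

theorem cfc_apply_add {C : H →L[ℂ] H} {φ ψ : ℝ → ℝ}
    (hφ : ContinuousOn φ (spectrum ℝ C)) (hψ : ContinuousOn ψ (spectrum ℝ C)) (x : H) :
    cfc (fun s => φ s + ψ s) C x = cfc φ C x + cfc ψ C x := by
  rw [cfc_add C φ ψ hφ hψ]
  rfl

theorem cfc_apply_const_mul {C : H →L[ℂ] H} {φ : ℝ → ℝ} (r : ℝ)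
    (hφ : ContinuousOn φ (spectrum ℝ C)) (x : H) :
    cfc (fun s => r * φ s) C x = (r : ℂ) • cfc φ C x := by
  rw [cfc_const_mul r φ C hφ]
  rfl

/-- The resolvent `(C + ε)⁻¹` through the functional calculus. -/
theorem apply_cfc_inv_add {C : H →L[ℂ] H} (hC : IsSelfAdjoint C) (hs : spectrum ℝ C ⊆ Icc 0 1)
    {ε : ℝ} (hε : 0 < ε) (x : H) :
    C (cfc (fun s => (s + ε)⁻¹) C x) + (ε : ℂ) • cfc (fun s => (s + ε)⁻¹) C x = x := by
  have hpos : ∀ s ∈ spectrum ℝ C, s + ε ≠ 0 := fun s h => by linarith [(hs h).1]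
  have hc : ContinuousOn (fun s : ℝ => (s + ε)⁻¹) (spectrum ℝ C) :=
    (by fun_prop : ContinuousOn (fun s : ℝ => s + ε) _).inv₀ hpos
  rw [apply_cfc_apply hC hc, ← cfc_apply_const_mul ε hc,
    ← cfc_apply_add (by exact continuousOn_id.mul hc) (by exact continuousOn_const.mul hc)]
  rw [cfc_congr (g := fun _ => (1 : ℝ)), cfc_const_one ℝ C]
  · rfl
  · intro s h
    have := hpos s h
    simp only
    field_simp

/-- Pairing `g = ζ C g` with `C g` gives `(C g, g) = ζ ‖C g‖²`; the left side is real, so `C g = 0`.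
-/
theorem sub_smul_apply_injective {C : H →L[ℂ] H} (hC : IsSelfAdjoint C) {ζ : ℂ} (hζ : ζ.im ≠ 0)
    {g : H} (hg : g - ζ • C g = 0) : g = 0 := by
  have h1 : g = ζ • C g := sub_eq_zero.1 hg
  have h2 : ⟪C g, g⟫_ℂ = ζ * ⟪C g, C g⟫_ℂ := by
    rw [← inner_smul_right, ← h1]
  have h3 : (⟪C g, g⟫_ℂ).im = 0 := by
    have : ((⟪C g, g⟫_ℂ).re : ℂ) = ⟪C g, g⟫_ℂ := hC.isSymmetric.coe_re_inner_apply_self g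
    rw [← this, Complex.ofReal_im]
  have h4 : C g = 0 := by
    rw [h2, inner_self_eq_norm_sq_to_K] at h3
    have : ζ.im * ‖C g‖ ^ 2 = 0 := by
      have h5 : ζ * ((‖C g‖ : ℂ)) ^ 2 = ζ * ((‖C g‖ ^ 2 : ℝ) : ℂ) := by push_cast; rfl
      have h6 : (ζ * ((‖C g‖ : ℂ)) ^ 2).im = 0 := h3
      rwa [h5, Complex.im_mul_ofReal] at h6
    simpa [hζ] using this
  rw [h1, h4, smul_zero]

theorem one_sub_mul_ne_zero {ζ : ℂ} (hζ : ζ.im ≠ 0) (s : ℝ) : 1 - ζ * s ≠ 0 := by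
  intro h
  have h1 := congrArg Complex.im h
  have h2 := congrArg Complex.re h
  simp [hζ] at h1 h2
  simp [h1] at h2

/-- The vector `(1 - ζ C)⁻¹ x` and its pairing with `x` through the spectral measure. -/
theorem exists_resolvent_integral {C : H →L[ℂ] H} (hC : IsSelfAdjoint C) {x : H} {ν : Measure ℝ}
    (hν : ∀ φ : ℝ → ℝ, ContinuousOn φ (spectrum ℝ C) →
        Integrable φ ν ∧ ⟪x, cfc φ C x⟫_ℂ = ∫ s, φ s ∂ν) {ζ : ℂ} (hζ : ζ.im ≠ 0) :
    ∃ g, g - ζ • C g = x ∧ ⟪x, g⟫_ℂ = ∫ s : ℝ, 1 / (1 - ζ * s) ∂ν := by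
  -- The calculus is real, so `(1 - ζ s)⁻¹` is split as `(1 - ζ̄ s) p(s)` with `p(s) = |1 - ζ s|⁻²`.
  let p : ℝ → ℝ := fun s => (Complex.normSq (1 - ζ * s))⁻¹
  have hp0 : ∀ s : ℝ, Complex.normSq (1 - ζ * s) ≠ 0 := fun s => by
    simpa using one_sub_mul_ne_zero hζ s
  have hcn : Continuous fun s : ℝ => Complex.normSq (1 - ζ * s) :=
    Complex.continuous_normSq.comp (by fun_prop)
  have hp : Continuous p := hcn.inv₀ hp0
  have hsp : Continuous fun s => s * p s := continuous_id.mul hp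
  have hssp : Continuous fun s => s * (s * p s) := continuous_id.mul hsp
  let y := cfc p C x
  have hCy : C y = cfc (fun s => s * p s) C x := apply_cfc_apply hC hp.continuousOn x
  have hCCy : C (C y) = cfc (fun s => s * (s * p s)) C x := by
    rw [hCy, apply_cfc_apply hC hsp.continuousOn]
  have hsum : y + ((-(2 * ζ.re) : ℝ) : ℂ) • C y + ((Complex.normSq ζ : ℝ) : ℂ) • C (C y) = x := by
    rw [hCCy, hCy, ← cfc_apply_const_mul _ hsp.continuousOn,
      ← cfc_apply_const_mul _ hssp.continuousOn,
      ← cfc_apply_add (by fun_prop) (by fun_prop), ← cfc_apply_add (by fun_prop) (by fun_prop),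
      cfc_congr (g := fun _ => (1 : ℝ)), cfc_const_one ℝ C]
    · rfl
    · intro s _
      have h1 := hp0 s
      have h2 : Complex.normSq (1 - ζ * s) = 1 - 2 * ζ.re * s + Complex.normSq ζ * (s * s) := by
        simp only [Complex.normSq_apply]
        simp
        ring
      have : p s * Complex.normSq (1 - ζ * s) = 1 := inv_mul_cancel₀ h1
      rw [h2] at this
      simp only
      linarith
  refine ⟨y - conj ζ • C y, ?_, ?_⟩
  · rw [← hsum, map_sub, map_smul, ← Complex.mul_conj]
    have h1 : ((-(2 * ζ.re) : ℝ) : ℂ) = -ζ - conj ζ := by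
      rw [← sub_eq_zero]
      have := Complex.add_conj ζ
      push_cast at this ⊢
      linear_combination this
    rw [h1]
    module
  · obtain ⟨i1, e1⟩ := hν p hp.continuousOn
    obtain ⟨i2, e2⟩ := hν _ hsp.continuousOn
    rw [inner_sub_right, inner_smul_right, hCy, e1, e2, ← integral_complex_ofReal,
      ← integral_complex_ofReal, ← integral_const_mul, ← integral_sub i1.ofReal
      (i2.ofReal.const_mul _)]
    refine integral_congr_ae (Eventually.of_forall fun s => ?_)
    have h1 := one_sub_mul_ne_zero hζ s
    have h2 : (1 - ζ * s) * (1 - conj ζ * s) = (Complex.normSq (1 - ζ * s) : ℂ) := by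
      rw [← Complex.mul_conj]
      simp
    have h3 : ((p s : ℝ) : ℂ) * (Complex.normSq (1 - ζ * s) : ℂ) = 1 := by
      rw [← Complex.ofReal_mul]
      simp only [p, inv_mul_cancel₀ (hp0 s), Complex.ofReal_one]
    rw [eq_div_iff h1]
    simp only
    push_cast
    rw [← h2] at h3
    linear_combination h3

end CfcResolvent

/-! ### The change of variable `t = s⁻¹ - 1` and distribution functions. -/

section StieltjesMeasure

/-- The image of the measure `s⁻² ν` under `s ↦ s⁻¹ - 1`. -/
noncomputable def inversionMeasure (ν : Measure ℝ) : Measure ℝ :=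
  (ν.withDensity fun s => (Real.toNNReal (s⁻¹ ^ 2) : ENNReal)).map fun s => s⁻¹ - 1

theorem measurable_toNNReal_inv_sq : Measurable fun s : ℝ => Real.toNNReal (s⁻¹ ^ 2) := by
  fun_prop

theorem integral_inversionMeasure {ν : Measure ℝ} {φ : ℝ → ℂ} (hφ : Measurable φ) :
    ∫ t, φ t ∂(inversionMeasure ν) = ∫ s : ℝ, ((s⁻¹ : ℝ) : ℂ) ^ 2 * φ (s⁻¹ - 1) ∂ν := by
  rw [inversionMeasure, integral_map (by fun_prop) hφ.aestronglyMeasurable,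
    integral_withDensity_eq_integral_smul measurable_toNNReal_inv_sq]
  refine integral_congr_ae (Eventually.of_forall fun s => ?_)
  simp only [NNReal.smul_def, Real.coe_toNNReal _ (sq_nonneg (s⁻¹)), Complex.real_smul]
  push_cast
  rfl

theorem integrable_inversionMeasure_iff {ν : Measure ℝ} {φ : ℝ → ℝ} (hφ : Measurable φ) :
    Integrable φ (inversionMeasure ν) ↔ Integrable (fun s => s⁻¹ ^ 2 * φ (s⁻¹ - 1)) ν := by
  rw [inversionMeasure, integrable_map_measure hφ.aestronglyMeasurable (by fun_prop),
    integrable_withDensity_iff_integrable_smul measurable_toNNReal_inv_sq]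
  refine integrable_congr (Eventually.of_forall fun s => ?_)
  simp only [NNReal.smul_def, Real.coe_toNNReal _ (sq_nonneg (s⁻¹)), smul_eq_mul,
    Function.comp_apply]

theorem inversionMeasure_apply {ν : Measure ℝ} {A : Set ℝ} (hA : MeasurableSet A) :
    inversionMeasure ν A =
      ∫⁻ s in (fun s : ℝ => s⁻¹ - 1) ⁻¹' A, (Real.toNNReal (s⁻¹ ^ 2) : ENNReal) ∂ν := by
  have hm : Measurable fun s : ℝ => s⁻¹ - 1 := by fun_prop
  rw [inversionMeasure, Measure.map_apply hm hA, withDensity_apply _ (hm hA)]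

theorem inversionMeasure_Iio_zero {ν : Measure ℝ} (hν : ∀ᵐ s ∂ν, s ∈ Ioc (0 : ℝ) 1) :
    inversionMeasure ν (Iio 0) = 0 := by
  have hm : Measurable fun s : ℝ => s⁻¹ - 1 := by fun_prop
  have : ν ((fun s : ℝ => s⁻¹ - 1) ⁻¹' Iio 0) = 0 := by
    refine measure_eq_zero_iff_ae_notMem.2 ?_
    filter_upwards [hν] with s hs h
    have h1 : 1 ≤ s⁻¹ := (one_le_inv₀ hs.1).2 hs.2
    simp only [mem_preimage, mem_Iio] at h
    linarith
  rw [inversionMeasure_apply measurableSet_Iio, Measure.restrict_eq_zero.2 this,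
    lintegral_zero_measure]

theorem inversionMeasure_Iio {ν : Measure ℝ} (hν : ∀ᵐ s ∂ν, s ∈ Ioc (0 : ℝ) 1)
    {t : ℝ} (ht : 0 ≤ t) :
    inversionMeasure ν (Iio t) =
      ∫⁻ s, ENNReal.ofReal ((Ioi (1 + t)⁻¹).indicator (fun s => s⁻¹ ^ 2) s) ∂ν := by
  have hm : Measurable fun s : ℝ => s⁻¹ - 1 := by fun_prop
  rw [inversionMeasure_apply measurableSet_Iio, ← lintegral_indicator (hm measurableSet_Iio)]
  refine lintegral_congr_ae ?_
  filter_upwards [hν] with s hs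
  have hiff : s⁻¹ - 1 < t ↔ (1 + t)⁻¹ < s := by
    rw [inv_lt_comm₀ (by linarith) hs.1]
    constructor <;> intro h <;> linarith
  by_cases h : s⁻¹ - 1 < t
  · rw [indicator_of_mem (show s ∈ _ from h), indicator_of_mem (mem_Ioi.2 (hiff.1 h))]
    rfl
  · rw [indicator_of_notMem (show s ∉ _ from h),
      indicator_of_notMem (mt mem_Ioi.1 fun h' => h (hiff.2 h'))]
    simp

theorem norm_indicator_inv_sq_le {a : ℝ} (ha : 0 < a) (s : ℝ) :
    ‖(Ioi a).indicator (fun s : ℝ => s⁻¹ ^ 2) s‖ ≤ a⁻¹ ^ 2 := by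
  by_cases h : s ∈ Ioi a
  · rw [indicator_of_mem h, Real.norm_of_nonneg (sq_nonneg _)]
    have : 0 ≤ s⁻¹ := inv_nonneg.2 (ha.le.trans (le_of_lt h))
    have : s⁻¹ ≤ a⁻¹ := inv_anti₀ ha (le_of_lt h)
    gcongr
  · rw [indicator_of_notMem h, norm_zero]
    positivity

theorem integrable_indicator_inv_sq {ν : Measure ℝ} [IsFiniteMeasure ν] {a : ℝ} (ha : 0 < a) :
    Integrable ((Ioi a).indicator (fun s : ℝ => s⁻¹ ^ 2)) ν :=
  Integrable.of_bound ((by fun_prop : Measurable fun s : ℝ => s⁻¹ ^ 2).indicator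
    measurableSet_Ioi).aestronglyMeasurable _ (Eventually.of_forall (norm_indicator_inv_sq_le ha))

theorem indicator_inv_sq_nonneg (a s : ℝ) : 0 ≤ (Ioi a).indicator (fun s : ℝ => s⁻¹ ^ 2) s :=
  indicator_nonneg (fun _ _ => sq_nonneg _) _

/-- The value at `t` of the future distribution function `(G(t) e, e)`. It is finite because `s⁻¹ -
1 < t` keeps `s` away from `0`, where the density `s⁻²` blows up. -/
theorem inversionMeasure_real_Iio {ν : Measure ℝ} [IsFiniteMeasure ν]
    (hν : ∀ᵐ s ∂ν, s ∈ Ioc (0 : ℝ) 1) {t : ℝ} (ht : 0 ≤ t) :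
    inversionMeasure ν (Iio t) ≠ ⊤ ∧ (inversionMeasure ν).real (Iio t) =
      ∫ s, (Ioi (1 + t)⁻¹).indicator (fun s => s⁻¹ ^ 2) s ∂ν := by
  have ha : 0 < (1 + t)⁻¹ := inv_pos.2 (by linarith)
  have h := ofReal_integral_eq_lintegral_ofReal (integrable_indicator_inv_sq (ν := ν) ha)
    (Eventually.of_forall (indicator_inv_sq_nonneg _))
  rw [Measure.real, inversionMeasure_Iio hν ht, ← h]
  exact ⟨ENNReal.ofReal_ne_top,
    ENNReal.toReal_ofReal (integral_nonneg (indicator_inv_sq_nonneg _))⟩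

theorem tendsto_add_one_div (t : ℝ) :
    Tendsto (fun n : ℕ => t + 1 / ((n : ℝ) + 1)) atTop (𝓝[>] t) := by
  refine tendsto_nhdsWithin_iff.2 ⟨?_, Eventually.of_forall fun n => ?_⟩
  · simpa using (tendsto_const_nhds (x := t)).add
      (tendsto_one_div_add_atTop_nhds_zero_nat (𝕜 := ℝ))
  · have : (0 : ℝ) < 1 / ((n : ℝ) + 1) := by positivity
    simp only [mem_Ioi]
    linarith

/-- The measure of a non-decreasing operator function whose form is the left-continuous
distribution function of a measure `μ` on `[0, ∞)` is `μ`. -/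
theorem NondecreasingOp.measure_eq {E : Type*} [NormedAddCommGroup E] [InnerProductSpace ℂ E]
    {G : ℝ → E →L[ℂ] E} (hG : NondecreasingOp G) (e : E) {μ : Measure ℝ}
    (hfin : ∀ t, 0 ≤ t → μ (Iio t) ≠ ⊤) (h0 : μ (Iio 0) = 0)
    (hq : ∀ t, 0 ≤ t → (⟪e, G t e⟫_ℂ).re = μ.real (Iio t)) : hG.measure e = μ := by
  have hIio : ∀ t, μ (Iio (max t 0)) = μ (Iio t) := fun t => by
    rcases le_total 0 t with h | h
    · rw [max_eq_left h]
    · rw [max_eq_right h, h0, measure_mono_null (Iio_subset_Iio h) h0]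
  have hfin' : ∀ t, μ (Iio t) ≠ ⊤ := fun t => hIio t ▸ hfin _ (le_max_right _ _)
  have hfin'' : ∀ t, μ (Iic t) ≠ ⊤ := fun t =>
    ne_top_of_le_ne_top (hfin' (t + 1)) (measure_mono fun s (hs : s ≤ t) => by
      simp only [mem_Iio]; linarith)
  have hfun : (fun t : ℝ => (⟪e, G (max t 0) e⟫_ℂ).re) = fun t => μ.real (Iio t) := by
    ext1 t
    rw [hq _ (le_max_right _ _), Measure.real, hIio, Measure.real]
  have hlim : ∀ t, (hG.monotone e).stieltjesFunction t = μ.real (Iic t) := fun t => by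
    rw [Monotone.stieltjesFunction_eq]
    have hseq := tendsto_add_one_div t
    have h1 := ((hG.monotone e).tendsto_rightLim t).comp hseq
    -- The right limit of the masses of `(-∞, t)` is the mass of `(-∞, t]`, by continuity from
    -- above.
    refine tendsto_nhds_unique h1 ?_
    have h2 : Tendsto (fun n : ℕ => μ (Iio (t + 1 / ((n : ℝ) + 1)))) atTop
        (𝓝 (μ (⋂ n : ℕ, Iio (t + 1 / ((n : ℝ) + 1))))) := by
      refine tendsto_measure_iInter_atTop (fun n => measurableSet_Iio.nullMeasurableSet) ?_
        ⟨0, hfin' _⟩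
      intro m n hmn
      refine Iio_subset_Iio ?_
      have : 1 / ((n : ℝ) + 1) ≤ 1 / ((m : ℝ) + 1) := by gcongr
      linarith
    have h3 : ⋂ n : ℕ, Iio (t + 1 / ((n : ℝ) + 1)) = Iic t := by
      ext s
      simp only [mem_iInter, mem_Iio, mem_Iic]
      refine ⟨fun h => ?_, fun h n => ?_⟩
      · exact ge_of_tendsto (hseq.mono_right nhdsWithin_le_nhds)
          (Eventually.of_forall fun n => (h n).le)
      · have : (0 : ℝ) < 1 / ((n : ℝ) + 1) := by positivity
        linarith
    rw [h3] at h2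
    have h4 := (ENNReal.tendsto_toReal (hfin'' t)).comp h2
    refine h4.congr fun n => ?_
    simp only [Function.comp_apply]
    exact (congrFun hfun _).symm
  rw [NondecreasingOp.measure]
  refine Measure.ext_of_Ioc _ _ fun a b hab => ?_
  rw [StieltjesFunction.measure_Ioc, hlim, hlim, ← Iic_sdiff_Iic,
    measure_sdiff (Iic_subset_Iic.2 hab.le) measurableSet_Iic.nullMeasurableSet (hfin'' a),
    ENNReal.ofReal_sub _ measureReal_nonneg, Measure.real, Measure.real,
    ENNReal.ofReal_toReal (hfin'' _), ENNReal.ofReal_toReal (hfin'' _)]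

end StieltjesMeasure

/-! ### From a dominated pair `C`, `F` to a Stieltjes representation. -/

section StieltjesRepresentation

/-- The atom at `0` has mass at most `ε v` for every `ε > 0`, so it vanishes. Fatou's lemma then
makes `s⁻¹` integrable, and `s⁻¹` dominates the integrands in the limit. -/
theorem integrable_inv_of_bound {ν : Measure ℝ} [IsFiniteMeasure ν]
    (h01 : ∀ᵐ s ∂ν, s ∈ Icc (0 : ℝ) 1) {v : ℝ}
    (hb : ∀ ε : ℝ, 0 < ε → Integrable (fun s => (s + ε)⁻¹) ν ∧ ∫ s, (s + ε)⁻¹ ∂ν ≤ v) :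
    (∀ᵐ s ∂ν, s ∈ Ioc (0 : ℝ) 1) ∧ Integrable (fun s => s⁻¹) ν ∧ ∫ s, s⁻¹ ∂ν ≤ v ∧
      Tendsto (fun n : ℕ => ∫ s, (s + 1 / ((n : ℝ) + 1))⁻¹ ∂ν) atTop (𝓝 (∫ s, s⁻¹ ∂ν)) := by
  have hnn : ∀ ε : ℝ, 0 < ε → ∀ᵐ s ∂ν, 0 ≤ (s + ε)⁻¹ := fun ε hε => by
    filter_upwards [h01] with s hs
    exact inv_nonneg.2 (add_nonneg hs.1 hε.le)
  have hzero : ν {0} = 0 := by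
    have h1 : ∀ ε : ℝ, 0 < ε → ν.real {0} ≤ ε * v := fun ε hε => by
      have h2 : ∫ s in {(0 : ℝ)}, (s + ε)⁻¹ ∂ν ≤ ∫ s, (s + ε)⁻¹ ∂ν :=
        setIntegral_le_integral (hb ε hε).1 (hnn ε hε)
      rw [integral_singleton, zero_add, smul_eq_mul] at h2
      have h3 := h2.trans (hb ε hε).2
      rwa [← div_eq_mul_inv, div_le_iff₀' hε] at h3
    have h2 : ν.real {0} ≤ 0 := by
      have : Tendsto (fun ε : ℝ => ε * v) (𝓝[>] 0) (𝓝 (0 * v)) :=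
        (tendsto_id.mono_left nhdsWithin_le_nhds).mul_const v
      rw [zero_mul] at this
      exact ge_of_tendsto this (eventually_mem_nhdsWithin.mono fun ε hε => h1 ε hε)
    exact (measureReal_eq_zero_iff).1 (le_antisymm h2 measureReal_nonneg)
  have h01' : ∀ᵐ s ∂ν, s ∈ Ioc (0 : ℝ) 1 := by
    filter_upwards [h01, measure_eq_zero_iff_ae_notMem.1 hzero] with s hs hs0
    exact ⟨lt_of_le_of_ne hs.1 fun h => hs0 h.symm, hs.2⟩
  have hseq : Tendsto (fun n : ℕ => 1 / ((n : ℝ) + 1)) atTop (𝓝 0) :=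
    tendsto_one_div_add_atTop_nhds_zero_nat
  have hpos : ∀ n : ℕ, (0 : ℝ) < 1 / ((n : ℝ) + 1) := fun n => by positivity
  have hlim : ∀ᵐ s ∂ν, Tendsto (fun n : ℕ => (s + 1 / ((n : ℝ) + 1))⁻¹) atTop (𝓝 s⁻¹) := by
    filter_upwards [h01'] with s hs
    have : Tendsto (fun n : ℕ => s + 1 / ((n : ℝ) + 1)) atTop (𝓝 s) := by
      simpa using hseq.const_add s
    exact this.inv₀ hs.1.ne'
  have hint : Integrable (fun s : ℝ => s⁻¹) ν := by
    refine ⟨(by fun_prop : Measurable fun s : ℝ => s⁻¹).aestronglyMeasurable, ?_⟩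
    rw [hasFiniteIntegral_iff_ofReal (by filter_upwards [h01] with s hs; exact inv_nonneg.2 hs.1)]
    have h1 : ∫⁻ s, ENNReal.ofReal s⁻¹ ∂ν ≤
        liminf (fun n : ℕ => ∫⁻ s, ENNReal.ofReal (s + 1 / ((n : ℝ) + 1))⁻¹ ∂ν) atTop := by
      refine le_trans (lintegral_mono_ae ?_) (lintegral_liminf_le fun n => by fun_prop)
      filter_upwards [hlim] with s hs
      exact ((ENNReal.continuous_ofReal.tendsto _).comp hs).liminf_eq.ge
    have h2 : ∀ n : ℕ, ∫⁻ s, ENNReal.ofReal (s + 1 / ((n : ℝ) + 1))⁻¹ ∂ν ≤ ENNReal.ofReal v :=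
      fun n => by
        rw [← ofReal_integral_eq_lintegral_ofReal (hb _ (hpos n)).1 (hnn _ (hpos n))]
        exact ENNReal.ofReal_le_ofReal (hb _ (hpos n)).2
    refine lt_of_le_of_lt (h1.trans ?_) (ENNReal.ofReal_lt_top (r := v))
    exact liminf_le_of_le (by isBoundedDefault) fun b hbb =>
      (hbb.exists.choose_spec).trans (h2 _)
  have htend : Tendsto (fun n : ℕ => ∫ s, (s + 1 / ((n : ℝ) + 1))⁻¹ ∂ν) atTop
      (𝓝 (∫ s, s⁻¹ ∂ν)) := by
    refine tendsto_integral_of_dominated_convergence (fun s => s⁻¹)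
      (fun n => (hb _ (hpos n)).1.aestronglyMeasurable) hint (fun n => ?_) hlim
    filter_upwards [h01'] with s hs
    have := hpos n
    rw [Real.norm_of_nonneg (inv_nonneg.2 (by linarith [hs.1]))]
    exact inv_anti₀ hs.1 (by linarith)
  exact ⟨h01', hint, le_of_tendsto htend (Eventually.of_forall fun n => (hb _ (hpos n)).2), htend⟩

/-- Continuous functions increasing to the indicator function of `(a, ∞)` times `s⁻²`. -/
noncomputable def cutoff (a : ℝ) (n : ℕ) (s : ℝ) : ℝ :=
  min 1 (n * max (s - a) 0) * (max s a)⁻¹ ^ 2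

theorem continuous_cutoff {a : ℝ} (ha : 0 < a) (n : ℕ) : Continuous (cutoff a n) := by
  have : Continuous fun s : ℝ => (max s a)⁻¹ :=
    (continuous_id.max continuous_const).inv₀ fun s => (lt_max_of_lt_right ha).ne'
  unfold cutoff
  fun_prop

theorem norm_cutoff_le {a : ℝ} (ha : 0 < a) (n : ℕ) (s : ℝ) : ‖cutoff a n s‖ ≤ a⁻¹ ^ 2 := by
  have h1 : 0 ≤ min 1 ((n : ℝ) * max (s - a) 0) := le_min zero_le_one (by positivity)
  have h2 : 0 < max s a := lt_max_of_lt_right ha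
  rw [cutoff, Real.norm_of_nonneg (by positivity)]
  calc _ ≤ 1 * a⁻¹ ^ 2 := by
        gcongr
        · exact min_le_left _ _
        · exact le_max_right _ _
    _ = _ := one_mul _

theorem tendsto_cutoff (a s : ℝ) :
    Tendsto (fun n => cutoff a n s) atTop (𝓝 ((Ioi a).indicator (fun s => s⁻¹ ^ 2) s)) := by
  by_cases h : a < s
  · rw [indicator_of_mem (mem_Ioi.2 h)]
    have h1 : ∀ᶠ n : ℕ in atTop, cutoff a n s = s⁻¹ ^ 2 := by
      have h2 : Tendsto (fun n : ℕ => (n : ℝ) * (s - a)) atTop atTop :=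
        tendsto_natCast_atTop_atTop.atTop_mul_const (sub_pos.2 h)
      filter_upwards [h2.eventually_ge_atTop 1] with n hn
      rw [cutoff, max_eq_left (sub_pos.2 h).le, max_eq_left h.le, min_eq_left hn, one_mul]
    exact tendsto_const_nhds.congr' (h1.mono fun n hn => hn.symm)
  · rw [indicator_of_notMem (mt mem_Ioi.1 h)]
    refine tendsto_const_nhds.congr fun n => ?_
    rw [cutoff, max_eq_right (sub_nonpos.2 (not_lt.1 h))]
    simp

variable {H : Type*} [NormedAddCommGroup H] [InnerProductSpace ℂ H] [CompleteSpace H]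
variable {E : Type*} [NormedAddCommGroup E] [InnerProductSpace ℂ E]

theorem isPositive_of_inner_eq_ofReal {M : E →L[ℂ] E} {q : E → ℝ}
    (h : ∀ e, ⟪e, M e⟫_ℂ = q e) (hq : ∀ e, 0 ≤ q e) : M.IsPositive := by
  rw [ContinuousLinearMap.isPositive_def]
  have h1 : ∀ e, ⟪M e, e⟫_ℂ = q e := fun e => by
    rw [← inner_conj_symm, h, Complex.conj_ofReal]
  refine ⟨?_, fun e => ?_⟩
  · rw [LinearMap.isSymmetric_iff_inner_map_self_real]
    intro e
    change conj ⟪M e, e⟫_ℂ = ⟪M e, e⟫_ℂ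
    rw [h1, Complex.conj_ofReal]
  · rw [ContinuousLinearMap.reApplyInnerSelf_apply, h1]
    exact hq e

/-- A bounded operator `0 ≤ C ≤ 1` and an operator `F` dominated by `C` in the sense of forms
give a Stieltjes function `V₀ + (z + 1) F* (1 - (z + 1) C)⁻¹ F`. -/
theorem exists_stieltjes_representation [FiniteDimensional ℂ E] {C : H →L[ℂ] H}
    (hC : IsSelfAdjoint C)
    (hs : spectrum ℝ C ⊆ Icc 0 1) (F : E →L[ℂ] H) (V₀ : E →L[ℂ] E)
    (hV₀ : ∀ e, (⟪e, V₀ e⟫_ℂ).im = 0) (hpos : ∀ e, 0 ≤ (⟪e, V₀ e⟫_ℂ).re)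
    (hb : ∀ k e, ‖⟪k, F e⟫_ℂ‖ ^ 2 ≤ (⟪k, C k⟫_ℂ).re * (⟪e, V₀ e⟫_ℂ).re) :
    ∃ (γ : E →L[ℂ] E) (G : ℝ → E →L[ℂ] E) (hG : NondecreasingOp G),
      γ.IsPositive ∧
      (∀ e : E, IntegrableOn (fun t : ℝ => 1 / (1 + t)) (Ici 0) (hG.measure e)) ∧
      ∀ z : ℂ, z.im ≠ 0 → ∀ (e : E) (g : H), g - (z + 1) • C g = F e →
        ⟪e, V₀ e⟫_ℂ + (z + 1) * ⟪F e, g⟫_ℂ =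
          ⟪e, γ e⟫_ℂ + ∫ t in Ici (0 : ℝ), 1 / ((t : ℂ) - z) ∂(hG.measure e) := by
  have hcE : CompleteSpace E := FiniteDimensional.complete ℂ E
  choose ν hνfin hνs hν using fun e : E => exists_spectral_measure hC (F e)
  have hν01 : ∀ e, ∀ᵐ s ∂(ν e), s ∈ Icc (0 : ℝ) 1 := fun e => (hνs e).mono fun s h => hs h
  have hV₀' : ∀ e, ⟪e, V₀ e⟫_ℂ = ((⟪e, V₀ e⟫_ℂ).re : ℂ) := fun e =>
    Complex.ext rfl (by rw [hV₀, Complex.ofReal_im])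
  have hcont : ∀ ε : ℝ, 0 < ε → ContinuousOn (fun s : ℝ => (s + ε)⁻¹) (spectrum ℝ C) :=
    fun ε hε => (by fun_prop : ContinuousOn (fun s : ℝ => s + ε) _).inv₀ fun s h => by
      linarith [(hs h).1]
  have hbd : ∀ e (ε : ℝ), 0 < ε → Integrable (fun s => (s + ε)⁻¹) (ν e) ∧
      ∫ s, (s + ε)⁻¹ ∂(ν e) ≤ (⟪e, V₀ e⟫_ℂ).re := by
    intro e ε hε
    obtain ⟨h1, h2⟩ := hν e _ (hcont ε hε)
    refine ⟨h1, ?_⟩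
    -- For `k = (C + ε)⁻¹ F e` both `(k, F e)` and `(k, C k) + ε ‖k‖²` equal `r`. The hypothesis
    -- becomes `r² ≤ r (V₀ e, e)`, whence `r ≤ (V₀ e, e)`.
    set k := cfc (fun s : ℝ => (s + ε)⁻¹) C (F e)
    have h3 : C k + (ε : ℂ) • k = F e := apply_cfc_inv_add hC hs hε (F e)
    set r := ∫ s, (s + ε)⁻¹ ∂(ν e)
    have h4 : ⟪k, F e⟫_ℂ = r := by rw [← inner_conj_symm, h2, Complex.conj_ofReal]
    have h5 := hb k e
    rw [h4, Complex.norm_real, Real.norm_eq_abs, sq_abs] at h5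
    have h6 : (⟪k, C k⟫_ℂ).re + ε * ‖k‖ ^ 2 = r := by
      have h7 := congrArg Complex.re h4
      rw [← h3, inner_add_right, inner_smul_right, inner_self_eq_norm_sq_to_K, Complex.add_re,
        Complex.re_ofReal_mul, Complex.ofReal_re] at h7
      rw [← h7]
      congr 2
      norm_cast
    have hr : 0 ≤ r := integral_nonneg_of_ae (by
      filter_upwards [hν01 e] with s hs
      exact inv_nonneg.2 (add_nonneg hs.1 hε.le))
    by_contra! hlt
    have h8 : (⟪k, C k⟫_ℂ).re ≤ r := by nlinarith [sq_nonneg ‖k‖]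
    nlinarith [hpos e]
  have key := fun e => integrable_inv_of_bound (hν01 e) (hbd e)
  choose h01 hinv hle htend using key
  -- the operator `γ`
  obtain ⟨γ, hγ⟩ : ∃ γ : E →L[ℂ] E,
      ∀ e, ⟪e, γ e⟫_ℂ = (((⟪e, V₀ e⟫_ℂ).re - ∫ s, s⁻¹ ∂(ν e) : ℝ) : ℂ) := by
    refine exists_quadratic_limit (l := atTop) (M := fun n : ℕ => V₀ -
      (ContinuousLinearMap.adjoint F).comp
        ((cfc (fun s : ℝ => (s + 1 / ((n : ℝ) + 1))⁻¹) C).comp F)) fun e => ?_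
    have h1 := (Complex.continuous_ofReal.tendsto _).comp
      ((htend e).const_sub ((⟪e, V₀ e⟫_ℂ).re))
    refine h1.congr fun n => ?_
    have h2 := (hν e _ (hcont (1 / ((n : ℝ) + 1)) (by positivity))).2
    simp only [Function.comp_apply, sub_apply, ContinuousLinearMap.comp_apply, inner_sub_right,
      ContinuousLinearMap.adjoint_inner_right, h2]
    rw [hV₀' e]
    push_cast
    simp
  -- the operator function `G`
  have hGex : ∀ t : ℝ, ∃ N : E →L[ℂ] E, 0 ≤ t →
      ∀ e, ⟪e, N e⟫_ℂ = ((inversionMeasure (ν e)).real (Iio t) : ℂ) := by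
    intro t
    by_cases ht : 0 ≤ t
    swap
    -- The value at negative `t` plays no role: neither `NondecreasingOp` nor its measure sees it.
    · exact ⟨0, fun h => absurd h ht⟩
    have ha : 0 < (1 + t)⁻¹ := inv_pos.2 (by linarith)
    obtain ⟨N, hN⟩ : ∃ N : E →L[ℂ] E, ∀ e, ⟪e, N e⟫_ℂ =
        ((∫ s, (Ioi (1 + t)⁻¹).indicator (fun s => s⁻¹ ^ 2) s ∂(ν e) : ℝ) : ℂ) := by
      -- The indicator of `(a, ∞)` is not continuous on the spectrum; the functional calculus is
      -- applied to the approximations `cutoff`.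
      refine exists_quadratic_limit (l := atTop) (M := fun n : ℕ =>
        (ContinuousLinearMap.adjoint F).comp ((cfc (cutoff (1 + t)⁻¹ n) C).comp F)) fun e => ?_
      have h1 : Tendsto (fun n : ℕ => ∫ s, cutoff (1 + t)⁻¹ n s ∂(ν e)) atTop
          (𝓝 (∫ s, (Ioi (1 + t)⁻¹).indicator (fun s => s⁻¹ ^ 2) s ∂(ν e))) :=
        tendsto_integral_of_dominated_convergence (fun _ => ((1 + t)⁻¹)⁻¹ ^ 2)
          (fun n => (continuous_cutoff ha n).aestronglyMeasurable) (integrable_const _)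
          (fun n => Eventually.of_forall (norm_cutoff_le ha n))
          (Eventually.of_forall (tendsto_cutoff _))
      refine ((Complex.continuous_ofReal.tendsto _).comp h1).congr fun n => ?_
      have h2 := (hν e _ (continuous_cutoff ha n).continuousOn).2
      simp only [Function.comp_apply, ContinuousLinearMap.comp_apply,
        ContinuousLinearMap.adjoint_inner_right, h2]
    exact ⟨N, fun _ e => by rw [hN, (inversionMeasure_real_Iio (h01 e) ht).2]⟩
  choose G hGq using hGex
  have hG : NondecreasingOp G := fun s t h0 hst => by
    refine isPositive_of_inner_eq_ofReal (q := fun e => (inversionMeasure (ν e)).real (Iio t) -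
      (inversionMeasure (ν e)).real (Iio s)) (fun e => ?_) fun e => ?_
    · rw [sub_apply, inner_sub_right, hGq t (h0.trans hst), hGq s h0]
      push_cast
      rfl
    · exact sub_nonneg.2 (measureReal_mono (Iio_subset_Iio hst)
        (inversionMeasure_real_Iio (h01 e) (h0.trans hst)).1)
  have hmeas : ∀ e, hG.measure e = inversionMeasure (ν e) := fun e =>
    hG.measure_eq e (fun t ht => (inversionMeasure_real_Iio (h01 e) ht).1)
      (inversionMeasure_Iio_zero (h01 e)) fun t ht => by rw [hGq t ht, Complex.ofReal_re]
  have hrestrict : ∀ e, (inversionMeasure (ν e)).restrict (Ici 0) = inversionMeasure (ν e) :=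
    fun e => Measure.restrict_eq_self_of_ae_mem (by
      have := measure_eq_zero_iff_ae_notMem.1 (inversionMeasure_Iio_zero (h01 e))
      filter_upwards [this] with t ht
      exact not_lt.1 (mt mem_Iio.2 ht))
  refine ⟨γ, G, hG, isPositive_of_inner_eq_ofReal hγ fun e => sub_nonneg.2 (hle e),
    fun e => ?_, fun z hz e g hg => ?_⟩
  · rw [hmeas, IntegrableOn, hrestrict, integrable_inversionMeasure_iff (by fun_prop)]
    refine (hinv e).congr ?_
    filter_upwards [h01 e] with s hs
    have := hs.1.ne'
    rw [add_sub_cancel, one_div, inv_inv, sq, mul_assoc, inv_mul_cancel₀ this, mul_one]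
  · have hζ : (z + 1).im ≠ 0 := by simpa using hz
    obtain ⟨g', hg', hgi⟩ := exists_resolvent_integral hC (hν e) hζ
    have hgg : g = g' := by
      rw [← sub_eq_zero]
      refine sub_smul_apply_injective hC hζ ?_
      rw [map_sub, smul_sub, sub_sub_sub_comm, hg, hg', sub_self]
    have hmz : Measurable fun t : ℝ => 1 / ((t : ℂ) - z) := by fun_prop
    rw [hgg, hgi, hmeas, hrestrict, integral_inversionMeasure hmz, hγ, hV₀' e]
    have h1 : Integrable (fun s : ℝ => (z + 1) * (1 / (1 - (z + 1) * s))) (ν e) := by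
      have hc : Continuous fun s : ℝ => (z + 1) * (1 / (1 - (z + 1) * s)) :=
        continuous_const.mul (continuous_const.div (by fun_prop) (one_sub_mul_ne_zero hζ))
      have := hc.continuousOn.integrableOn_compact (μ := ν e) (isCompact_Icc (a := 0) (b := 1))
      rwa [IntegrableOn, Measure.restrict_eq_self_of_ae_mem (hν01 e)] at this
    -- With `t = s⁻¹ - 1` the partial fraction identity is `s⁻² / (t - z) = (z + 1) / (1 - (z + 1)
    -- s) + s⁻¹`; the last term is what `γ` loses.
    have h2 : ∫ s : ℝ, ((s⁻¹ : ℝ) : ℂ) ^ 2 * (1 / (((s⁻¹ - 1 : ℝ) : ℂ) - z)) ∂(ν e) =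
        ∫ s : ℝ, ((z + 1) * (1 / (1 - (z + 1) * s)) + ((s⁻¹ : ℝ) : ℂ)) ∂(ν e) := by
      refine integral_congr_ae ?_
      filter_upwards [h01 e] with s hs
      have h3 := one_sub_mul_ne_zero hζ s
      have h4 : (s : ℂ) ≠ 0 := by exact_mod_cast hs.1.ne'
      have h5 : ((s⁻¹ - 1 : ℝ) : ℂ) - z = (1 - (z + 1) * s) / s := by
        push_cast
        field_simp
        ring
      rw [h5]
      obtain ⟨w, hw⟩ : ∃ w, w = 1 - (z + 1) * s := ⟨_, rfl⟩
      have h6 : z + 1 = (1 - w) / s := by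
        rw [hw]
        field_simp
        ring
      rw [← hw] at h3 ⊢
      rw [h6]
      push_cast
      field_simp
      ring
    have h7 : Integrable (fun s : ℝ => ((s⁻¹ : ℝ) : ℂ)) (ν e) := (hinv e).ofReal
    rw [h2, integral_add h1 h7, integral_const_mul, integral_complex_ofReal]
    rw [Complex.ofReal_re]
    push_cast
    ring

end StieltjesRepresentation

/-! ### Positivity of the kernel of a Stieltjes function. -/

section StieltjesKernel

variable {E : Type*} [NormedAddCommGroup E] [InnerProductSpace ℂ E]

/-- The kernel `(z V(z) - w̄ V(w)*) / (z - w̄)` of an operator function is non-negative. -/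
def KernelNonneg (V : ℂ → E →L[ℂ] E) : Prop :=
  ∀ (n : ℕ) (z : Fin n → ℂ) (e : Fin n → E), (∀ k, (z k).im ≠ 0) →
    (∀ k l, z k ≠ conj (z l)) →
    0 ≤ (∑ k, ∑ l, (z k * ⟪e l, V (z k) (e k)⟫_ℂ - conj (z l) * ⟪V (z l) (e l), e k⟫_ℂ) /
      (z k - conj (z l))).re

theorem KernelNonneg.add {V W : ℂ → E →L[ℂ] E} (hV : KernelNonneg V) (hW : KernelNonneg W) :
    KernelNonneg fun z => V z + W z := by
  intro n z e hz hzz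
  refine (add_nonneg (hV n z e hz hzz) (hW n z e hz hzz)).trans_eq ?_
  rw [← Complex.add_re, ← Finset.sum_add_distrib]
  congr 1
  refine Finset.sum_congr rfl fun k _ => ?_
  rw [← Finset.sum_add_distrib]
  refine Finset.sum_congr rfl fun l _ => ?_
  rw [← add_div, add_apply, add_apply, inner_add_left, inner_add_right]
  ring

theorem KernelNonneg.sum {ι : Type*} (s : Finset ι) {V : ι → ℂ → E →L[ℂ] E}
    (hV : ∀ i ∈ s, KernelNonneg (V i)) : KernelNonneg fun z => ∑ i ∈ s, V i z := by
  classical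
  induction s using Finset.induction_on with
  | empty => intro n z e _ _; simp
  | insert i s hi ih =>
    simp only [Finset.sum_insert hi]
    exact (hV i (Finset.mem_insert_self _ _)).add
      (ih fun j hj => hV j (Finset.mem_insert_of_mem hj))

/-- The quotient is the constant `γ`, so the double sum is the form of `γ` at `∑ e k`. -/
theorem KernelNonneg.const {γ : E →L[ℂ] E} (hγ : γ.IsPositive) : KernelNonneg fun _ => γ := by
  intro n z e hz hzz
  have h := hγ.re_inner_nonneg_right (∑ k, e k)
  refine h.trans_eq ?_
  rw [map_sum, inner_sum]
  simp only [sum_inner]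
  change Complex.re _ = _
  congr 1
  refine Finset.sum_congr rfl fun k _ => Finset.sum_congr rfl fun l _ => ?_
  rw [hγ.inner_left_eq_inner_right, ← sub_mul, mul_div_right_comm,
    div_self (sub_ne_zero.2 (hzz k l)), one_mul]

theorem ofReal_sub_ne_zero {z : ℂ} (hz : z.im ≠ 0) (t : ℝ) : (t : ℂ) - z ≠ 0 := fun h => by
  have := congrArg Complex.im h
  simp [hz] at this

/-- The quotient equals `t / ((t - z) (t - w̄))` times `D`, a Gram kernel as soon as `t ≥ 0`; this
is where the support `[0, ∞)` matters. -/
theorem KernelNonneg.inv_sub_smul {D : E →L[ℂ] E} (hD : D.IsPositive) {t : ℝ} (ht : 0 ≤ t) :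
    KernelNonneg fun z => (1 / ((t : ℂ) - z)) • D := by
  intro n z e hz hzz
  have h := hD.re_inner_nonneg_right (∑ k, (1 / ((t : ℂ) - z k)) • e k)
  refine (mul_nonneg ht h).trans_eq ?_
  rw [map_sum, inner_sum]
  simp only [sum_inner]
  change t * Complex.re _ = _
  rw [← Complex.re_ofReal_mul, Finset.mul_sum]
  congr 1
  refine Finset.sum_congr rfl fun k _ => ?_
  rw [Finset.mul_sum]
  refine Finset.sum_congr rfl fun l _ => ?_
  have h1 := ofReal_sub_ne_zero (hz k) t
  have h2 : (t : ℂ) - conj (z l) ≠ 0 := ofReal_sub_ne_zero (by simpa using hz l) t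
  have h3 := sub_ne_zero.2 (hzz k l)
  rw [smul_apply, smul_apply, inner_smul_right, inner_smul_left, map_smul,
    inner_smul_right, inner_smul_left, hD.inner_left_eq_inner_right]
  simp only [map_div₀, map_one, map_sub, Complex.conj_ofReal]
  field_simp
  ring

theorem KernelNonneg.of_tendsto {α : Type*} {l : Filter α} [l.NeBot] {V : α → ℂ → E →L[ℂ] E}
    {W : ℂ → E →L[ℂ] E} (hV : ∀ a, KernelNonneg (V a))
    (h : ∀ z : ℂ, z.im ≠ 0 → ∀ e, Tendsto (fun a => ⟪e, V a z e⟫_ℂ) l (𝓝 ⟪e, W z e⟫_ℂ)) :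
    KernelNonneg W := by
  intro n z e hz hzz
  have h1 : ∀ z : ℂ, z.im ≠ 0 → ∀ x y, Tendsto (fun a => ⟪x, V a z y⟫_ℂ) l (𝓝 ⟪x, W z y⟫_ℂ) :=
    fun z hz => tendsto_inner_map_of_quadratic (h z hz)
  have h2 : ∀ z : ℂ, z.im ≠ 0 → ∀ x y, Tendsto (fun a => ⟪V a z x, y⟫_ℂ) l (𝓝 ⟪W z x, y⟫_ℂ) :=
    fun z hz x y => by
      have := (Complex.continuous_conj.tendsto _).comp (h1 z hz y x)
      simpa only [Function.comp_def, inner_conj_symm] using this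
  refine ge_of_tendsto' ((Complex.continuous_re.tendsto _).comp (tendsto_finsetSum _ fun k _ =>
    tendsto_finsetSum _ fun l _ => (((h1 _ (hz k) (e l) (e k)).const_mul (z k)).sub
      ((h2 _ (hz l) (e l) (e k)).const_mul (conj (z l)))).div_const (z k - conj (z l))))
    fun a => hV a n z e hz hzz

/-- The Stieltjes function of `hG.measure e` takes right limits, so the operator is a limit of
increments of `G` taken slightly to the right of `a` and `b`. -/
theorem NondecreasingOp.exists_increment [FiniteDimensional ℂ E] {G : ℝ → E →L[ℂ] E}
    (hG : NondecreasingOp G) {a b : ℝ} (hab : a ≤ b) :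
    ∃ D : E →L[ℂ] E, D.IsPositive ∧ ∀ e, ⟪e, D e⟫_ℂ = (hG.measure e).real (Ioc a b) := by
  obtain ⟨D, hD⟩ : ∃ D : E →L[ℂ] E, ∀ e, ⟪e, D e⟫_ℂ = (hG.measure e).real (Ioc a b) := by
    refine exists_quadratic_limit (l := atTop) (M := fun n : ℕ =>
      G (max (b + 1 / ((n : ℝ) + 1)) 0) - G (max (a + 1 / ((n : ℝ) + 1)) 0)) fun e => ?_
    have hF : ∀ t, Tendsto (fun n : ℕ => (⟪e, G (max (t + 1 / ((n : ℝ) + 1)) 0) e⟫_ℂ).re) atTop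
        (𝓝 ((hG.monotone e).stieltjesFunction t)) := fun t => by
      rw [Monotone.stieltjesFunction_eq]
      exact ((hG.monotone e).tendsto_rightLim t).comp (tendsto_add_one_div t)
    have hm : (hG.measure e).real (Ioc a b) =
        (hG.monotone e).stieltjesFunction b - (hG.monotone e).stieltjesFunction a := by
      rw [Measure.real, NondecreasingOp.measure, StieltjesFunction.measure_Ioc,
        ENNReal.toReal_ofReal (sub_nonneg.2 ((hG.monotone e).stieltjesFunction.mono hab))]
    rw [hm]
    refine ((Complex.continuous_ofReal.tendsto _).comp ((hF b).sub (hF a))).congr fun n => ?_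
    have hp := hG (max (a + 1 / ((n : ℝ) + 1)) 0) (max (b + 1 / ((n : ℝ) + 1)) 0)
      (le_max_right _ _) (max_le_max_right _ (by linarith))
    have := hp.isSymmetric.coe_re_inner_self_apply e
    simp only [Function.comp_apply]
    rw [← Complex.sub_re, ← inner_sub_right, ← sub_apply]
    exact this
  exact ⟨D, isPositive_of_inner_eq_ofReal hD fun e => measureReal_nonneg, hD⟩

theorem NondecreasingOp.measure_Iio_zero {G : ℝ → E →L[ℂ] E} (hG : NondecreasingOp G) (e : E) :
    hG.measure e (Iio 0) = 0 := by
  have h1 : Iio (0 : ℝ) ⊆ ⋃ n : ℕ, Ioc (-(n : ℝ)) (-(1 / ((n : ℝ) + 1))) := by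
    intro t (ht : t < 0)
    obtain ⟨n, hn⟩ := exists_nat_gt (max (-t) (1 / (-t)))
    refine mem_iUnion.2 ⟨n, ?_, ?_⟩
    · linarith [le_max_left (-t) (1 / (-t))]
    · have h2 : 1 / (-t) < (n : ℝ) + 1 := by linarith [le_max_right (-t) (1 / (-t))]
      have h3 : 1 / ((n : ℝ) + 1) ≤ -t := by
        rw [div_lt_iff₀ (by linarith)] at h2
        rw [div_le_iff₀ (by positivity)]
        linarith
      linarith
  refine measure_mono_null h1 (measure_iUnion_null fun n => ?_)
  rw [NondecreasingOp.measure, StieltjesFunction.measure_Ioc, ENNReal.ofReal_eq_zero, sub_nonpos,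
    Monotone.stieltjesFunction_eq, Monotone.stieltjesFunction_eq]
  have h2 := (hG.monotone e).rightLim_le (x := -(1 / ((n : ℝ) + 1))) (y := 0)
    (neg_lt_zero.2 (by positivity))
  have h3 := (hG.monotone e).le_rightLim (le_refl (-(n : ℝ)))
  refine h2.trans (le_trans (le_of_eq ?_) h3)
  simp

/-- An integrable majorant for Riemann sums with right-hand nodes `τ`, from `1 + t ≤ 1 + τ ≤ |τ - z|
+ |1 + z|`. -/
theorem norm_one_div_ofReal_sub_le {z : ℂ} (hz : z.im ≠ 0) {t τ : ℝ} (ht : 0 ≤ t) (h : t ≤ τ) :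
    ‖1 / ((τ : ℂ) - z)‖ ≤ (1 + ‖1 + z‖ / |z.im|) * (1 / (1 + t)) := by
  have h1 : 0 < ‖(τ : ℂ) - z‖ := norm_pos_iff.2 (ofReal_sub_ne_zero hz τ)
  have h2 : |z.im| ≤ ‖(τ : ℂ) - z‖ := by
    have := Complex.abs_im_le_norm ((τ : ℂ) - z)
    simpa using this
  have h3 : 1 + τ ≤ ‖(τ : ℂ) - z‖ + ‖1 + z‖ := by
    have := norm_add_le ((τ : ℂ) - z) (1 + z)
    have h4 : (τ : ℂ) - z + (1 + z) = ((1 + τ : ℝ) : ℂ) := by push_cast; ring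
    rwa [h4, Complex.norm_real, Real.norm_of_nonneg (by linarith)] at this
  have h5 : ‖1 + z‖ ≤ ‖1 + z‖ / |z.im| * ‖(τ : ℂ) - z‖ := by
    rw [div_mul_eq_mul_div, le_div_iff₀ (abs_pos.2 hz)]
    gcongr
  rw [norm_div, norm_one, mul_one_div, div_le_div_iff₀ h1 (by linarith)]
  linarith

/-- The integral is a limit of Riemann sums with positive operator weights, and `KernelNonneg` holds
for each term and survives sums and limits. -/
theorem IsStieltjes.kernelNonneg [FiniteDimensional ℂ E] {V : ℂ → E →L[ℂ] E}
    (hV : IsStieltjes V) : KernelNonneg V := by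
  obtain ⟨-, γ, G, hG, hγ, hint, hrep⟩ := hV
  have hIoc : ∀ n j : ℕ, ((j : ℝ) - 1) / ((n : ℝ) + 1) ≤ (j : ℝ) / ((n : ℝ) + 1) := fun n j => by
    gcongr
    linarith
  choose D hDpos hD using fun n j : ℕ => hG.exists_increment (hIoc n j)
  refine KernelNonneg.of_tendsto (l := atTop) (V := fun (n : ℕ) z => γ +
    ∑ j ∈ Finset.range ((n + 1) * (n + 1)), (1 / (((j : ℝ) / ((n : ℝ) + 1) : ℝ) - z)) • D n j)
    (fun n => (KernelNonneg.const hγ).add (KernelNonneg.sum _ fun j _ =>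
      KernelNonneg.inv_sub_smul (hDpos n j) (by positivity))) fun z hz e => ?_
  rw [hrep z hz e]
  simp only [add_apply, inner_add_right]
  refine tendsto_const_nhds.add ?_
  set μ := hG.measure e with hμ
  have hae : ∀ᵐ t ∂μ, t ∈ Ici (0 : ℝ) := by
    filter_upwards [measure_eq_zero_iff_ae_notMem.1 (hG.measure_Iio_zero e)] with t ht
    exact not_lt.1 (mt mem_Iio.2 ht)
  have hint' := hint e
  rw [← hμ, IntegrableOn, Measure.restrict_eq_self_of_ae_mem hae] at hint'
  rw [Measure.restrict_eq_self_of_ae_mem hae]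
  -- Cells of length `1 / (n + 1)` closed on the right: the cell `j = 0` ends at `0` and catches the
  -- atom there.
  let I : ℕ → ℕ → Set ℝ := fun n j => Ioc (((j : ℝ) - 1) / ((n : ℝ) + 1)) ((j : ℝ) / ((n : ℝ) + 1))
  let φ : ℕ → ℝ → ℂ := fun n t => ∑ j ∈ Finset.range ((n + 1) * (n + 1)),
    (I n j).indicator (fun _ => 1 / (((j : ℝ) / ((n : ℝ) + 1) : ℝ) - z)) t
  have hfinI : ∀ n j, μ (I n j) ≠ ⊤ := fun n j => by
    rw [hμ, NondecreasingOp.measure]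
    exact measure_Ioc_lt_top.ne
  have hφ_int : ∀ n, ∫ t, φ n t ∂μ = ⟪e, (∑ j ∈ Finset.range ((n + 1) * (n + 1)),
      (1 / (((j : ℝ) / ((n : ℝ) + 1) : ℝ) - z)) • D n j) e⟫_ℂ := by
    intro n
    rw [integral_finsetSum _ fun j _ => (integrable_indicator_iff measurableSet_Ioc).2
      (integrableOn_const (hfinI n j)), sum_apply, inner_sum]
    refine Finset.sum_congr rfl fun j _ => ?_
    rw [integral_indicator measurableSet_Ioc, setIntegral_const, smul_apply, inner_smul_right, hD,
      Complex.real_smul, mul_comm]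
  simp only [← hφ_int]
  have hmem : ∀ n j t, 0 ≤ t → (t ∈ I n j ↔ ⌈t * ((n : ℝ) + 1)⌉₊ = j) := by
    intro n j t ht
    have hn : (0 : ℝ) < (n : ℝ) + 1 := by positivity
    simp only [I, mem_Ioc, div_lt_iff₀ hn, le_div_iff₀ hn]
    cases j with
    | zero =>
      rw [Nat.ceil_eq_zero]
      have : 0 ≤ t * ((n : ℝ) + 1) := by positivity
      simp only [Nat.cast_zero]
      exact ⟨fun h => h.2, fun h => ⟨by linarith, h⟩⟩
    | succ j =>
      rw [Nat.ceil_eq_iff (Nat.succ_ne_zero j)]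
      simp
  have hφ_eq : ∀ n t, 0 ≤ t → φ n t = if ⌈t * ((n : ℝ) + 1)⌉₊ < (n + 1) * (n + 1) then
      1 / (((⌈t * ((n : ℝ) + 1)⌉₊ : ℝ) / ((n : ℝ) + 1) : ℝ) - z) else 0 := by
    intro n t ht
    simp only [φ, indicator_apply, hmem n _ t ht, Finset.sum_ite_eq, Finset.mem_range]
  refine tendsto_integral_of_dominated_convergence
    (fun t => (1 + ‖1 + z‖ / |z.im|) * (1 / (1 + t))) (fun n => ?_) (hint'.const_mul _)
    (fun n => ?_) ?_
  · exact (Finset.measurable_sum _ fun j _ =>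
      measurable_const.indicator measurableSet_Ioc).aestronglyMeasurable
  · filter_upwards [hae] with t ht
    have ht : 0 ≤ t := ht
    have hn : (0 : ℝ) < (n : ℝ) + 1 := by positivity
    rw [hφ_eq n t ht]
    split_ifs
    · refine norm_one_div_ofReal_sub_le hz ht ?_
      rw [le_div_iff₀ hn]
      exact Nat.le_ceil _
    · rw [norm_zero]
      positivity
  · filter_upwards [hae] with t ht
    have ht : 0 ≤ t := ht
    have hN : Tendsto (fun n : ℕ => (n : ℝ) + 1) atTop atTop :=
      tendsto_atTop_add_const_right _ _ tendsto_natCast_atTop_atTop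
    have h1 := (tendsto_nat_ceil_mul_div_atTop ht).comp hN
    have h2 : Tendsto (fun n : ℕ => 1 / (((⌈t * ((n : ℝ) + 1)⌉₊ : ℝ) / ((n : ℝ) + 1) : ℝ) - z))
        atTop (𝓝 (1 / ((t : ℂ) - z))) :=
      tendsto_const_nhds.div (((Complex.continuous_ofReal.tendsto _).comp h1).sub_const z)
        (ofReal_sub_ne_zero hz t)
    refine h2.congr' ?_
    filter_upwards [h1.eventually_lt_const (lt_add_one t), hN.eventually_ge_atTop (t + 1)]
      with n hn1 hn2
    have hn : (0 : ℝ) < (n : ℝ) + 1 := by positivity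
    rw [hφ_eq n t ht, if_pos]
    simp only [Function.comp_apply] at hn1
    rw [div_lt_iff₀ hn] at hn1
    -- The `(n + 1)²` cells reach up to about `n`, hence past `t` once `t + 1 ≤ n + 1`.
    have : ((⌈t * ((n : ℝ) + 1)⌉₊ : ℕ) : ℝ) < (((n + 1) * (n + 1) : ℕ) : ℝ) := by
      push_cast
      nlinarith
    exact_mod_cast this

end StieltjesKernel

/-! ### The triplet, and the resolvent of the quasi-kernel. -/

namespace RiggedSystem

section Triplet

variable {H : Type*} [NormedAddCommGroup H] [InnerProductSpace ℂ H] [CompleteSpace H]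

theorem HPlus.norm_sq (A : H →ₗ.[ℂ] H) (f : HPlus A) :
    ‖f‖ ^ 2 = ‖HPlus.incl A f‖ ^ 2 + ‖HPlus.star A f‖ ^ 2 := by
  rw [← inner_self_eq_norm_sq (𝕜 := ℂ) f, HPlus.inner_def, map_add, inner_self_eq_norm_sq,
    inner_self_eq_norm_sq]

theorem HPlus.norm_star_le (A : H →ₗ.[ℂ] H) (f : HPlus A) : ‖HPlus.star A f‖ ≤ 1 * ‖f‖ := by
  rw [one_mul]
  exact le_of_sq_le_sq (by nlinarith [HPlus.norm_sq A f, sq_nonneg ‖HPlus.incl A f‖])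
    (norm_nonneg _)

/-- The operator `A*` as a bounded operator on `H₊`. -/
noncomputable def HPlus.starL (A : H →ₗ.[ℂ] H) : HPlus A →L[ℂ] H :=
  (HPlus.star A).mkContinuous 1 (HPlus.norm_star_le A)

variable {A : H →ₗ.[ℂ] H}

theorem HPlus.norm_le (f : HPlus A) : ‖f‖ ≤ ‖HPlus.incl A f‖ + ‖HPlus.star A f‖ :=
  le_of_sq_le_sq (by
    have h1 := norm_nonneg (HPlus.incl A f)
    have h2 := norm_nonneg (HPlus.star A f)
    nlinarith [HPlus.norm_sq A f]) (by positivity)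

theorem HPlus.incl_injective : Function.Injective (HPlus.incl A) := fun _ _ h => Subtype.ext h

theorem HPlus.exists_of_inner (hA : Dense (A.domain : Set H)) {x y : H}
    (h : ∀ a : A.domain, ⟪y, (a : H)⟫_ℂ = ⟪x, A a⟫_ℂ) :
    ∃ f : HPlus A, HPlus.incl A f = x ∧ HPlus.star A f = y := by
  have hx : x ∈ A†.domain := LinearPMap.mem_adjoint_domain_of_exists x ⟨y, h⟩
  exact ⟨(⟨x, hx⟩ : A†.domain), rfl, LinearPMap.adjoint_apply_eq hA ⟨x, hx⟩ h⟩

theorem HPlus.inner_star (hA : Dense (A.domain : Set H)) (f : HPlus A) (a : A.domain) :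
    ⟪HPlus.star A f, (a : H)⟫_ℂ = ⟪HPlus.incl A f, A a⟫_ℂ :=
  LinearPMap.adjoint_isFormalAdjoint hA (show A†.domain from f) a

theorem HPlus.exists_of_mem_domain (hA : Dense (A.domain : Set H)) (hs : A.IsFormalAdjoint A)
    (a : A.domain) : ∃ f : HPlus A, HPlus.incl A f = a ∧ HPlus.star A f = A a :=
  HPlus.exists_of_inner hA fun b => hs a b

/-- This is closedness of `A*`: the adjoint relation passes to limits in the graph norm. -/
theorem HPlus.completeSpace (hA : Dense (A.domain : Set H)) : CompleteSpace (HPlus A) := by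
  refine Metric.complete_of_cauchySeq_tendsto fun u hu => ?_
  obtain ⟨x, hx⟩ := cauchySeq_tendsto_of_complete
    ((HPlus.inclL A).uniformContinuous.comp_cauchySeq hu)
  obtain ⟨y, hy⟩ := cauchySeq_tendsto_of_complete
    ((HPlus.starL A).uniformContinuous.comp_cauchySeq hu)
  obtain ⟨f, hf, hf'⟩ : ∃ f : HPlus A, HPlus.incl A f = x ∧ HPlus.star A f = y :=
    HPlus.exists_of_inner hA fun a => by
      refine tendsto_nhds_unique (hy.inner tendsto_const_nhds) ?_
      refine (hx.inner (tendsto_const_nhds (x := A a))).congr fun n => ?_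
      exact (HPlus.inner_star hA (u n) a).symm
  refine ⟨f, tendsto_iff_norm_sub_tendsto_zero.2 ?_⟩
  have h1 := (tendsto_iff_norm_sub_tendsto_zero.1 hx).add (tendsto_iff_norm_sub_tendsto_zero.1 hy)
  rw [add_zero] at h1
  refine squeeze_zero (fun n => norm_nonneg _) (fun n => ?_) h1
  have := HPlus.norm_le (u n - f)
  rw [map_sub, map_sub, hf, hf'] at this
  exact this

theorem HMinus.ofH_injective (hA : Dense (A.domain : Set H)) (hs : A.IsFormalAdjoint A) :
    Function.Injective (HMinus.ofH A) := by
  intro h k hk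
  refine hA.eq_of_inner_right ℂ fun a ha => ?_
  obtain ⟨f, hf, -⟩ := HPlus.exists_of_mem_domain hA hs ⟨a, ha⟩
  have := congrArg (fun φ : HMinus A => φ f) hk
  simp only [HMinus.ofH_apply, hf] at this
  exact this

variable {B : HPlus A →L[ℂ] HMinus A}

theorem IsSelfAdjointBiExtension.conj_apply (hB : IsSelfAdjointBiExtension B) (f g : HPlus A) :
    conj (B g f) = B f g := by
  conv_rhs => rw [← hB.adj_eq]
  rfl

/-- The quasi-kernel is a restriction of `A*`, as seen by testing `B f = h` on `D(A)` and using the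
symmetry of `B`. -/
theorem IsSelfAdjointBiExtension.star_eq (hA : Dense (A.domain : Set H))
    (hB : IsSelfAdjointBiExtension B) {f : HPlus A} {h : H} (hf : B f = HMinus.ofH A h) :
    HPlus.star A f = h := by
  refine hA.eq_of_inner_left ℂ fun a ha => ?_
  obtain ⟨g, hg, hg'⟩ := hB.extends_base ⟨a, ha⟩
  have h1 := hB.conj_apply f g
  rw [hf, hg', HMinus.ofH_apply, HMinus.ofH_apply, hg, inner_conj_symm] at h1
  rw [HPlus.inner_star hA f ⟨a, ha⟩, ← inner_conj_symm, h1, inner_conj_symm]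

/-- Self-adjointness of the quasi-kernel as maximality: a pair orthogonal to its graph in the
adjoint sense lies in it. -/
theorem IsSelfAdjointBiExtension.exists_of_inner (hA : Dense (A.domain : Set H))
    (hs : A.IsFormalAdjoint A) (hB : IsSelfAdjointBiExtension B) {x y : H}
    (h : ∀ g k, B g = HMinus.ofH A k → ⟪k, x⟫_ℂ = ⟪HPlus.incl A g, y⟫_ℂ) :
    ∃ f, HPlus.incl A f = x ∧ B f = HMinus.ofH A y := by
  have hq := hB.isSelfAdjoint_quasiKernel
  have hd := hq.dense_domain
  -- `Submodule.toLinearPMap` has the prescribed graph only if that relation is single-valued, which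
  -- follows from injectivity of `H → H₋`.
  have hg : (quasiKernel B).graph = _ := Submodule.toLinearPMap_graph_eq _ (by
    rintro ⟨p, q⟩ ⟨f, hf, hf'⟩ (hp : p = 0)
    have hf0 : f = 0 := HPlus.incl_injective (by rw [hf, map_zero]; exact hp)
    rw [hf0, map_zero] at hf'
    exact HMinus.ofH_injective hA hs (by rw [← hf', map_zero]))
  have h1 := LinearPMap.adjoint_graph_eq_graph_adjoint hd
  rw [LinearPMap.isSelfAdjoint_def.1 hq] at h1
  have h2 : (x, y) ∈ (quasiKernel B).graph := by
    rw [h1, Submodule.mem_adjoint_iff]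
    intro a b hab
    rw [hg] at hab
    obtain ⟨g, hg1, hg2⟩ := hab
    rw [h g b hg2, hg1, sub_self]
  rw [hg] at h2
  exact h2

/-- The resolvent of the quasi-kernel at a point where the quasi-kernel is bounded from below. -/
theorem IsSelfAdjointBiExtension.exists_resolvent (hA : Dense (A.domain : Set H))
    (hs : A.IsFormalAdjoint A) (hB : IsSelfAdjointBiExtension B) {z : ℂ} {c : ℝ} (hc : 0 < c)
    (h1 : ∀ f, B f = HMinus.ofH A (HPlus.star A f) →
      c * ‖HPlus.incl A f‖ ≤ ‖HPlus.star A f - z • HPlus.incl A f‖)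
    (h2 : ∀ f, B f = HMinus.ofH A (HPlus.star A f) →
      c * ‖HPlus.incl A f‖ ≤ ‖HPlus.star A f - conj z • HPlus.incl A f‖) :
    ∃ r : H →L[ℂ] HPlus A, ∀ h, B (r h) = HMinus.ofH A (HPlus.star A (r h)) ∧
      HPlus.star A (r h) - z • HPlus.incl A (r h) = h := by
  have hcomp := HPlus.completeSpace hA
  let L : HPlus A →L[ℂ] HMinus A := B - (HMinus.ofH A).comp (HPlus.starL A)
  let D : Submodule ℂ (HPlus A) := LinearMap.ker L.toLinearMap
  have hD : ∀ f, f ∈ D ↔ B f = HMinus.ofH A (HPlus.star A f) := fun f => by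
    rw [LinearMap.mem_ker]
    exact sub_eq_zero
  have hDclosed : IsClosed (D : Set (HPlus A)) := L.isClosed_ker
  have hDcomp : CompleteSpace D := hDclosed.completeSpace_coe
  let Φ : D →L[ℂ] H := (HPlus.starL A - z • HPlus.inclL A).comp D.subtypeL
  have hΦ : ∀ f : D, Φ f = HPlus.star A f - z • HPlus.incl A (f : HPlus A) := fun f => rfl
  have hanti : ∃ K, AntilipschitzWith K Φ := by
    refine ⟨_, AddMonoidHomClass.antilipschitz_of_bound (K := Real.toNNReal (1 + (1 + ‖z‖) / c)) Φ
      fun f => ?_⟩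
    have e1 := h1 f ((hD f).1 f.2)
    rw [← hΦ] at e1
    have e2 := HPlus.norm_le (f : HPlus A)
    have e3 : ‖HPlus.star A (f : HPlus A)‖ ≤ ‖Φ f‖ + ‖z‖ * ‖HPlus.incl A (f : HPlus A)‖ := by
      rw [← norm_smul, hΦ]
      exact norm_le_norm_sub_add _ _
    have e4 : ‖HPlus.incl A (f : HPlus A)‖ ≤ ‖Φ f‖ / c := by
      rw [le_div_iff₀ hc]
      linarith
    rw [Real.coe_toNNReal _ (by positivity)]
    change ‖(f : HPlus A)‖ ≤ _
    have e5 : (1 + ‖z‖) * ‖HPlus.incl A (f : HPlus A)‖ ≤ (1 + ‖z‖) * (‖Φ f‖ / c) := by gcongr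
    calc _ ≤ _ := e2
      _ ≤ ‖Φ f‖ + (1 + ‖z‖) * (‖Φ f‖ / c) := by linarith
      _ = _ := by ring
  -- The range is closed by the lower bound at `z`. A vector orthogonal to it is an eigenvector of
  -- the quasi-kernel at `z̄`, excluded by the lower bound there.
  have hbij : Function.Bijective Φ := by
    rw [ContinuousLinearMap.bijective_iff_dense_range_and_antilipschitz]
    refine ⟨?_, hanti⟩
    rw [Submodule.topologicalClosure_eq_top_iff, Submodule.eq_bot_iff]
    intro x hx
    obtain ⟨f, hf, hf'⟩ := hB.exists_of_inner hA hs (x := x) (y := conj z • x) fun g k hgk => by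
      have hk := hB.star_eq hA hgk
      have hgD : g ∈ D := (hD g).2 (by rw [hk, hgk])
      have := hx (Φ ⟨g, hgD⟩) ⟨⟨g, hgD⟩, rfl⟩
      rw [hΦ, inner_sub_left, inner_smul_left, sub_eq_zero, hk] at this
      rw [this, inner_smul_right]
    have hst := hB.star_eq hA hf'
    have := h2 f (by rw [hst, hf'])
    rw [hst, hf, sub_self, norm_zero] at this
    have hx0 : ‖x‖ ≤ 0 := by nlinarith [norm_nonneg x]
    exact norm_le_zero_iff.1 hx0
  let e := ContinuousLinearEquiv.ofBijective Φ (LinearMap.ker_eq_bot.2 hbij.1)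
    (LinearMap.range_eq_top.2 hbij.2)
  refine ⟨D.subtypeL.comp (e.symm : H →L[ℂ] D), fun h => ⟨(hD _).1 (e.symm h).2, ?_⟩⟩
  exact e.apply_symm_apply h

end Triplet

end RiggedSystem

/-! ### Lower bounds, density of `D(T) + D(T*)`, and the range of `Re 𝔸 - A*`. -/

namespace RiggedSystem

theorem le_norm_of_le_norm_inner {H : Type*} [NormedAddCommGroup H] [InnerProductSpace ℂ H]
    {x y : H} {c : ℝ} (h : c * ‖x‖ ^ 2 ≤ ‖⟪x, y⟫_ℂ‖) :
    c * ‖x‖ ≤ ‖y‖ := by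
  rcases eq_or_ne x 0 with rfl | hx
  · simp
  · have h1 := h.trans (norm_inner_le_norm x y)
    have h2 : 0 < ‖x‖ := norm_pos_iff.2 hx
    refine le_of_mul_le_mul_left ?_ h2
    linarith [sq ‖x‖, mul_comm c (‖x‖ * ‖x‖), mul_assoc ‖x‖ c ‖x‖, mul_left_comm c ‖x‖ ‖x‖]

theorem inner_self_ofReal {H : Type*} [NormedAddCommGroup H] [InnerProductSpace ℂ H]
    (x : H) : ⟪x, x⟫_ℂ = ((‖x‖ ^ 2 : ℝ) : ℂ) := by
  rw [inner_self_eq_norm_sq_to_K]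
  norm_cast

section Extensions

variable {H : Type*} [NormedAddCommGroup H] [InnerProductSpace ℂ H] [CompleteSpace H]
variable {A : H →ₗ.[ℂ] H} {B : HPlus A →L[ℂ] HMinus A}

theorem IsSelfAdjointBiExtension.apply_self_im (hB : IsSelfAdjointBiExtension B) (f : HPlus A) :
    (B f f).im = 0 := Complex.conj_eq_iff_im.1 (hB.conj_apply f f)

theorem IsSelfAdjointBiExtension.abs_im_mul_norm_le (hB : IsSelfAdjointBiExtension B)
    {f : HPlus A} (hf : B f = HMinus.ofH A (HPlus.star A f)) (z : ℂ) :
    |z.im| * ‖HPlus.incl A f‖ ≤ ‖HPlus.star A f - z • HPlus.incl A f‖ := by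
  refine le_norm_of_le_norm_inner ?_
  have h1 := hB.apply_self_im f
  rw [hf, HMinus.ofH_apply] at h1
  refine le_trans (le_of_eq ?_) (Complex.abs_im_le_norm _)
  rw [inner_sub_right, inner_smul_right, Complex.sub_im, h1, inner_self_ofReal,
    Complex.im_mul_ofReal, zero_sub, abs_neg, abs_mul,
    abs_of_nonneg (sq_nonneg ‖HPlus.incl A f‖)]

theorem norm_le_of_accretive (hB : ∀ f, 0 ≤ (B f f).re)
    {f : HPlus A} (hf : B f = HMinus.ofH A (HPlus.star A f)) :
    1 * ‖HPlus.incl A f‖ ≤ ‖HPlus.star A f - (-1 : ℂ) • HPlus.incl A f‖ := by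
  refine le_norm_of_le_norm_inner ?_
  have h1 := hB f
  rw [hf, HMinus.ofH_apply] at h1
  refine le_trans ?_ ((le_abs_self _).trans (Complex.abs_re_le_norm _))
  rw [inner_sub_right, inner_smul_right, Complex.sub_re, inner_self_ofReal]
  simp only [neg_mul, one_mul, Complex.neg_re, Complex.ofReal_re]
  linarith

theorem IsSelfAdjointBiExtension.exists_resolvent_of_im (hA : Dense (A.domain : Set H))
    (hs : A.IsFormalAdjoint A) (hB : IsSelfAdjointBiExtension B) {z : ℂ} (hz : z.im ≠ 0) :
    ∃ r : H →L[ℂ] HPlus A, ∀ h, B (r h) = HMinus.ofH A (HPlus.star A (r h)) ∧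
      HPlus.star A (r h) - z • HPlus.incl A (r h) = h :=
  hB.exists_resolvent hA hs (abs_pos.2 hz) (fun f hf => hB.abs_im_mul_norm_le hf z)
    fun f hf => by simpa using hB.abs_im_mul_norm_le hf (conj z)

variable {T : H →ₗ.[ℂ] H}

theorem exists_hPlus_of_mem (hA : Dense (A.domain : Set H)) (hT : A ≤ T) (hT' : A ≤ T†)
    (t : T.domain) : ∃ g : HPlus A, HPlus.incl A g = t ∧ HPlus.star A g = T t := by
  have hTd : Dense (T.domain : Set H) := hA.mono hT.1
  refine HPlus.exists_of_inner hA fun a => ?_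
  have h1 : T† ⟨a, hT'.1 a.2⟩ = A a := (hT'.2 rfl).symm
  rw [← h1]
  exact (LinearPMap.adjoint_isFormalAdjoint hTd).symm t ⟨a, hT'.1 a.2⟩

theorem exists_hPlus_of_mem_adjoint (hA : Dense (A.domain : Set H)) (hT : A ≤ T)
    (t : T†.domain) : ∃ g : HPlus A, HPlus.incl A g = t ∧ HPlus.star A g = T† t := by
  have hTd : Dense (T.domain : Set H) := hA.mono hT.1
  refine HPlus.exists_of_inner hA fun a => ?_
  have h1 : T ⟨a, hT.1 a.2⟩ = A a := (hT.2 rfl).symm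
  rw [← h1]
  exact LinearPMap.adjoint_isFormalAdjoint hTd t ⟨a, hT.1 a.2⟩

/-- `T* - z̄` is onto for a regular point `z` of `T`. -/
theorem IsRegularPoint.adjoint_surjective (hTd : Dense (T.domain : Set H)) {z : ℂ}
    (hz : IsRegularPoint T z) (h : H) : ∃ t : T†.domain, T† t - conj z • (t : H) = h := by
  obtain ⟨R, -, hR⟩ := hz
  have h1 : ∀ x : T.domain, ⟪h + conj z • ContinuousLinearMap.adjoint R h, (x : H)⟫_ℂ =
      ⟪ContinuousLinearMap.adjoint R h, T x⟫_ℂ := fun x => by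
    have h2 := hR x
    have h3 : ⟪ContinuousLinearMap.adjoint R h, T x - z • (x : H)⟫_ℂ = ⟪h, (x : H)⟫_ℂ := by
      rw [ContinuousLinearMap.adjoint_inner_left, h2]
    rw [inner_sub_right, inner_smul_right] at h3
    rw [inner_add_left, inner_smul_left, Complex.conj_conj, ← h3]
    ring
  have hm := LinearPMap.mem_adjoint_domain_of_exists _ ⟨_, h1⟩
  refine ⟨⟨_, hm⟩, ?_⟩
  rw [LinearPMap.adjoint_apply_eq hTd ⟨_, hm⟩ h1]
  simp

/-- Orthogonality in `H₊` to `D(T)` says `T* A* f = -f`; orthogonality to `D(T*)` puts `A* f` in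
`D(T)`. So `A* f ∈ D(A)` and `A A* f = -f`, which gives `‖A* f‖² = -‖f‖²` in `H`. -/
theorem eq_zero_of_inner_domains (hA : Dense (A.domain : Set H)) (hT : A ≤ T) (hT' : A ≤ T†)
    (hdom : A.domain = T.domain ⊓ T†.domain) (hreg : ∃ z, IsRegularPoint T z) {f : HPlus A}
    (h1 : ∀ g : HPlus A, HPlus.incl A g ∈ T.domain → ⟪g, f⟫_ℂ = 0)
    (h2 : ∀ g : HPlus A, HPlus.incl A g ∈ T†.domain → ⟪g, f⟫_ℂ = 0) : f = 0 := by
  have hTd : Dense (T.domain : Set H) := hA.mono hT.1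
  have e1 : ∀ t : T.domain, ⟪-HPlus.incl A f, (t : H)⟫_ℂ = ⟪HPlus.star A f, T t⟫_ℂ := fun t => by
    obtain ⟨g, hg, hg'⟩ := exists_hPlus_of_mem hA hT hT' t
    have h3 := h1 g (hg ▸ t.2)
    rw [HPlus.inner_def, hg, hg'] at h3
    have h4 := congrArg conj h3
    rw [map_add, inner_conj_symm, inner_conj_symm, map_zero] at h4
    rw [inner_neg_left]
    linear_combination -h4
  have hm1 : HPlus.star A f ∈ T†.domain := LinearPMap.mem_adjoint_domain_of_exists _ ⟨_, e1⟩
  have hval : T† ⟨_, hm1⟩ = -HPlus.incl A f := LinearPMap.adjoint_apply_eq hTd ⟨_, hm1⟩ e1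
  have hm2 : HPlus.star A f ∈ T.domain := by
    obtain ⟨z, hz⟩ := hreg
    obtain ⟨R, hR, -⟩ := id hz
    -- The vector `u` solves `(T - z) u = -f - z A* f`. It is `A* f` because the two agree against
    -- the range of `T* - z̄`, which is all of `H`.
    obtain ⟨u, -, hu⟩ := hR (-HPlus.incl A f - z • HPlus.star A f)
    have hus : (u : H) = HPlus.star A f := by
      refine ext_inner_left ℂ fun h => ?_
      obtain ⟨t, ht⟩ := hz.adjoint_surjective hTd h
      obtain ⟨g, hg, hg'⟩ := exists_hPlus_of_mem_adjoint hA hT t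
      have h3 := h2 g (hg ▸ t.2)
      rw [HPlus.inner_def, hg, hg'] at h3
      have h4 := LinearPMap.adjoint_isFormalAdjoint hTd t u
      have h5 : T u = -HPlus.incl A f - z • HPlus.star A f + z • (u : H) := by
        rw [← hu]; abel
      rw [h5, inner_add_right, inner_sub_right, inner_smul_right, inner_smul_right,
        inner_neg_right] at h4
      rw [← ht, inner_sub_left, inner_sub_left, inner_smul_left, inner_smul_left,
        Complex.conj_conj]
      linear_combination h4 - h3
    exact hus ▸ u.2
  have hm : HPlus.star A f ∈ A.domain := hdom ▸ ⟨hm2, hm1⟩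
  have h3 := HPlus.inner_star hA f ⟨_, hm⟩
  have h4 : A ⟨_, hm⟩ = -HPlus.incl A f := by rw [← hval]; exact hT'.2 rfl
  rw [h4, inner_neg_right, inner_self_ofReal, inner_self_ofReal] at h3
  have h5 : ‖HPlus.star A f‖ ^ 2 = -‖HPlus.incl A f‖ ^ 2 := by exact_mod_cast h3
  have h6 := HPlus.norm_sq A f
  have h7 : ‖f‖ ^ 2 = 0 := by linarith
  exact norm_eq_zero.1 (pow_eq_zero_iff two_ne_zero |>.1 h7)

theorem topologicalClosure_domains (hA : Dense (A.domain : Set H)) (hT : A ≤ T) (hT' : A ≤ T†)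
    (hdom : A.domain = T.domain ⊓ T†.domain) (hreg : ∃ z, IsRegularPoint T z) :
    (T.domain.comap (HPlus.incl A) ⊔ T†.domain.comap (HPlus.incl A)).topologicalClosure = ⊤ := by
  have := HPlus.completeSpace hA
  rw [Submodule.topologicalClosure_eq_top_iff, Submodule.eq_bot_iff]
  intro f hf
  rw [Submodule.mem_orthogonal] at hf
  exact eq_zero_of_inner_domains hA hT hT' hdom hreg
    (fun g hg => hf g (Submodule.mem_sup_left hg)) fun g hg => hf g (Submodule.mem_sup_right hg)

variable {M : HPlus A →L[ℂ] HMinus A}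

/-- The operator `Re M - A*` from `H₊` to `H₋`. -/
noncomputable def boundaryPart (M : HPlus A →L[ℂ] HMinus A) : HPlus A →L[ℂ] HMinus A :=
  rePart M - (HMinus.ofH A).comp (HPlus.starL A)

theorem boundaryPart_apply (f : HPlus A) :
    boundaryPart M f = rePart M f - HMinus.ofH A (HPlus.star A f) := rfl

/-- On `D(T)` one has `Re M + i Im M = M = A*`. The companion for `D(T*)` starts from `Re M - i Im M
= A*`, whence the opposite sign. -/
theorem imPart_of_mem (hA : Dense (A.domain : Set H)) (hM : IsStarExtension M T) {g : HPlus A}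
    (hg : HPlus.incl A g ∈ T.domain) : imPart M g = Complex.I • boundaryPart M g := by
  have h1 : M g = HMinus.ofH A (HPlus.star A g) := by
    obtain ⟨f, hf, hf'⟩ := hM.extends_T ⟨_, hg⟩
    obtain ⟨k, hk, hk'⟩ := exists_hPlus_of_mem hA hM.le_T hM.le_T_adjoint ⟨_, hg⟩
    have e1 : f = g := HPlus.incl_injective hf
    have e2 : k = g := HPlus.incl_injective hk
    rw [e1] at hf'
    rw [e2] at hk'
    rw [hf', hk']
  rw [boundaryPart_apply, ← h1, rePart, imPart]
  simp only [smul_apply, add_apply, sub_apply, one_div, mul_inv, Complex.inv_I]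
  module

theorem imPart_of_mem_adjoint (hA : Dense (A.domain : Set H)) (hM : IsStarExtension M T)
    {g : HPlus A} (hg : HPlus.incl A g ∈ T†.domain) :
    imPart M g = (-Complex.I) • boundaryPart M g := by
  have h1 : adj M g = HMinus.ofH A (HPlus.star A g) := by
    obtain ⟨f, hf, hf'⟩ := hM.adj_extends_T_adjoint ⟨_, hg⟩
    obtain ⟨k, hk, hk'⟩ := exists_hPlus_of_mem_adjoint hA hM.le_T ⟨_, hg⟩
    have e1 : f = g := HPlus.incl_injective hf
    have e2 : k = g := HPlus.incl_injective hk
    rw [e1] at hf'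
    rw [e2] at hk'
    rw [hf', hk']
  rw [boundaryPart_apply, ← h1, rePart, imPart]
  simp only [smul_apply, add_apply, sub_apply, one_div, mul_inv, Complex.inv_I]
  module

theorem range_le_of_topologicalClosure {X Y : Type*} [NormedAddCommGroup X] [NormedSpace ℂ X]
    [NormedAddCommGroup Y] [NormedSpace ℂ Y] {W : Submodule ℂ X} (hW : W.topologicalClosure = ⊤)
    (L : X →L[ℂ] Y) {P : Submodule ℂ Y} [FiniteDimensional ℂ P] (h : ∀ x ∈ W, L x ∈ P) :
    LinearMap.range L.toLinearMap ≤ P := by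
  have hcl : IsClosed ((P.comap L.toLinearMap : Submodule ℂ X) : Set X) :=
    P.closed_of_finiteDimensional.preimage L.continuous
  have h1 := W.topologicalClosure_minimal (t := P.comap L.toLinearMap) h hcl
  rintro _ ⟨x, rfl⟩
  exact h1 (hW ▸ Submodule.mem_top)

/-- The operators `Im M` and `Re M - A*` have the same range. -/
theorem range_boundaryPart (hA : Dense (A.domain : Set H)) (hM : IsStarExtension M T)
    (hdom : A.domain = T.domain ⊓ T†.domain)
    [FiniteDimensional ℂ (LinearMap.range (imPart M).toLinearMap)] :
    LinearMap.range (boundaryPart M).toLinearMap = LinearMap.range (imPart M).toLinearMap := by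
  have hW := topologicalClosure_domains hA hM.le_T hM.le_T_adjoint hdom hM.exists_regularPoint
  have h1 : LinearMap.range (boundaryPart M).toLinearMap ≤
      LinearMap.range (imPart M).toLinearMap := by
    refine range_le_of_topologicalClosure hW _ fun x hx => ?_
    obtain ⟨t, ht, t', ht', rfl⟩ := Submodule.mem_sup.1 hx
    -- The factors `∓i` undo the factors `±i` by which `imPart` and `boundaryPart` differ on the two
    -- domains.
    refine ⟨(-Complex.I) • t + Complex.I • t', ?_⟩
    change imPart M _ = boundaryPart M _
    rw [map_add, map_add, map_smul, map_smul, imPart_of_mem hA hM ht,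
      imPart_of_mem_adjoint hA hM ht', smul_smul, smul_smul]
    simp
  have : FiniteDimensional ℂ (LinearMap.range (boundaryPart M).toLinearMap) :=
    Submodule.finiteDimensional_of_le h1
  refine le_antisymm h1 ?_
  refine range_le_of_topologicalClosure hW _ fun x hx => ?_
  obtain ⟨t, ht, t', ht', rfl⟩ := Submodule.mem_sup.1 hx
  refine ⟨Complex.I • t + (-Complex.I) • t', ?_⟩
  change boundaryPart M _ = imPart M _
  rw [map_add, map_add, map_smul, map_smul, imPart_of_mem hA hM ht,
    imPart_of_mem_adjoint hA hM ht']

end Extensions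

end RiggedSystem

/-! ### `V_Θ` is well defined, with its symmetry and positivity. -/

namespace RiggedCanonicalSystem

open RiggedSystem

variable {H E : Type*}
  [NormedAddCommGroup H] [InnerProductSpace ℂ H] [CompleteSpace H]
  [NormedAddCommGroup E] [InnerProductSpace ℂ E] [FiniteDimensional ℂ E]
  (Θ : RiggedCanonicalSystem H E)

theorem biExtension : IsSelfAdjointBiExtension (rePart Θ.main) :=
  Θ.isStarExtension.rePart_biExtension

theorem shifted_apply (z : ℂ) (f : HPlus Θ.A) :
    Θ.shifted z f = rePart Θ.main f - z • HMinus.ofH Θ.A (HPlus.incl Θ.A f) := rfl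

theorem shifted_eq_boundaryPart (z : ℂ) (f : HPlus Θ.A) :
    Θ.shifted z f = boundaryPart Θ.main f +
      HMinus.ofH Θ.A (HPlus.star Θ.A f - z • HPlus.incl Θ.A f) := by
  rw [shifted_apply, boundaryPart_apply, map_sub, map_smul]
  abel

theorem range_boundaryPart_eq : LinearMap.range (boundaryPart Θ.main).toLinearMap =
    LinearMap.range (imPart Θ.main).toLinearMap := by
  have h : LinearMap.range (imPart Θ.main).toLinearMap ≤ LinearMap.range Θ.K.toLinearMap := by
    rw [Θ.imPart_main]
    rintro _ ⟨f, rfl⟩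
    exact ⟨Θ.J (channelAdj Θ.K f), rfl⟩
  have : FiniteDimensional ℂ (LinearMap.range (imPart Θ.main).toLinearMap) :=
    Submodule.finiteDimensional_of_le h
  exact range_boundaryPart Θ.dense_A Θ.isStarExtension Θ.domain_A

/-- A bounded resolvent of the quasi-kernel of `Re 𝔸` at `z`. -/
def IsResolvent (z : ℂ) (r : H →L[ℂ] HPlus Θ.A) : Prop :=
  ∀ h, rePart Θ.main (r h) = HMinus.ofH Θ.A (HPlus.star Θ.A (r h)) ∧
    HPlus.star Θ.A (r h) - z • HPlus.incl Θ.A (r h) = h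

variable {Θ}

theorem IsResolvent.shifted_apply {z : ℂ} {r : H →L[ℂ] HPlus Θ.A} (hr : Θ.IsResolvent z r)
    (h : H) : Θ.shifted z (r h) = HMinus.ofH Θ.A h := by
  conv_rhs => rw [← (hr h).2]
  rw [RiggedCanonicalSystem.shifted_apply, (hr h).1, map_sub, map_smul]

/-- A kernel vector of `Re 𝔸 - z` is an eigenvector of the quasi-kernel, excluded by the lower
bound. For the range, `boundaryPart` reaches `Ran (Im 𝔸)`, and `r` corrects the remainder, which
lies in `H`. -/
theorem IsResolvent.isDefinedAt {z : ℂ} {r : H →L[ℂ] HPlus Θ.A} (hr : Θ.IsResolvent z r)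
    (hK : ∀ e : E, ∃ (f : HPlus Θ.A) (h : H),
      Θ.K e = imPart Θ.main f + HMinus.ofH Θ.A h) {c : ℝ} (hc : 0 < c)
    (hb : ∀ f, rePart Θ.main f = HMinus.ofH Θ.A (HPlus.star Θ.A f) →
      c * ‖HPlus.incl Θ.A f‖ ≤ ‖HPlus.star Θ.A f - z • HPlus.incl Θ.A f‖) :
    Θ.IsDefinedAt z := by
  refine ⟨(injective_iff_map_eq_zero _).2 fun f hf => ?_, fun e => ?_⟩
  · rw [Θ.shifted_apply, sub_eq_zero, ← map_smul] at hf
    have h1 := Θ.biExtension.star_eq Θ.dense_A hf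
    have h2 := hb f (by rw [h1, hf])
    rw [h1, sub_self, norm_zero] at h2
    have h3 : ‖HPlus.incl Θ.A f‖ ≤ 0 := by nlinarith [norm_nonneg (HPlus.incl Θ.A f)]
    exact HPlus.incl_injective (by rw [norm_le_zero_iff.1 h3, map_zero])
  · obtain ⟨f, h, hf⟩ := hK e
    have h1 : imPart Θ.main f ∈ LinearMap.range (boundaryPart Θ.main).toLinearMap := by
      rw [Θ.range_boundaryPart_eq]
      exact ⟨f, rfl⟩
    obtain ⟨f', hf'⟩ := h1
    have hf' : boundaryPart Θ.main f' = imPart Θ.main f := hf'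
    refine ⟨f' + r (h - (HPlus.star Θ.A f' - z • HPlus.incl Θ.A f')), ?_⟩
    rw [map_add, hr.shifted_apply, Θ.shifted_eq_boundaryPart, hf', hf, add_assoc,
      ← map_add, add_sub_cancel]

theorem exists_isResolvent {z : ℂ} (hz : z.im ≠ 0) : ∃ r, Θ.IsResolvent z r :=
  Θ.biExtension.exists_resolvent_of_im Θ.dense_A Θ.symmetric_A hz

theorem isDefinedAt_of_im {z : ℂ} (hz : z.im ≠ 0)
    (hK : ∀ e : E, ∃ (f : HPlus Θ.A) (h : H),
      Θ.K e = imPart Θ.main f + HMinus.ofH Θ.A h) : Θ.IsDefinedAt z := by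
  obtain ⟨r, hr⟩ := exists_isResolvent (Θ := Θ) hz
  exact hr.isDefinedAt hK (abs_pos.2 hz) fun f hf => Θ.biExtension.abs_im_mul_norm_le hf z

theorem inner_V_apply {z : ℂ} (h : Θ.IsDefinedAt z) {e : E} {u : HPlus Θ.A}
    (hu : Θ.shifted z u = Θ.K e) (e' : E) : ⟪e', Θ.V z e⟫_ℂ = conj (Θ.K e' u) := by
  have h1 : Θ.invK h e = u := h.1 (by rw [Θ.shifted_invK h e, hu])
  have h2 : Θ.V z e = channelAdj Θ.K (Θ.invK h e) := by
    rw [V, dif_pos h]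
    rfl
  rw [h2, inner_channelAdj, h1]

/-- Here `K e'` is replaced by `(Re 𝔸 - w) v`. `V_inner_eq` expresses `V(w)*` through the same two
quantities, so the pair can be solved for the form of `Re 𝔸`. -/
theorem inner_V_eq {z w : ℂ} (h : Θ.IsDefinedAt z) {e e' : E} {u v : HPlus Θ.A}
    (hu : Θ.shifted z u = Θ.K e) (hv : Θ.shifted w v = Θ.K e') :
    ⟪e', Θ.V z e⟫_ℂ =
      rePart Θ.main u v - conj w * ⟪HPlus.incl Θ.A v, HPlus.incl Θ.A u⟫_ℂ := by
  rw [inner_V_apply h hu, ← hv, Θ.shifted_apply, sub_apply, smul_apply, HMinus.ofH_apply, map_sub,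
    Θ.biExtension.conj_apply, smul_eq_mul, map_mul, inner_conj_symm]

theorem V_inner_eq {z w : ℂ} (h : Θ.IsDefinedAt w) {e e' : E} {u v : HPlus Θ.A}
    (hu : Θ.shifted z u = Θ.K e) (hv : Θ.shifted w v = Θ.K e') :
    ⟪Θ.V w e', e⟫_ℂ = rePart Θ.main u v - z * ⟪HPlus.incl Θ.A v, HPlus.incl Θ.A u⟫_ℂ := by
  rw [← inner_conj_symm, inner_V_eq h hv hu, map_sub, Θ.biExtension.conj_apply, map_mul,
    Complex.conj_conj, inner_conj_symm]

theorem V_symm {z : ℂ} (hz : Θ.IsDefinedAt z) (hz' : Θ.IsDefinedAt (conj z)) (x y : E) :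
    ⟪Θ.V z x, y⟫_ℂ = ⟪x, Θ.V (conj z) y⟫_ℂ := by
  obtain ⟨u, hu⟩ := hz.2 x
  obtain ⟨v, hv⟩ := hz'.2 y
  rw [V_inner_eq hz hv hu, inner_V_eq hz' hv hu]

theorem V_im_nonneg {z : ℂ} (h : Θ.IsDefinedAt z) (hz : 0 < z.im) (e : E) :
    0 ≤ (⟪e, Θ.V z e⟫_ℂ).im := by
  obtain ⟨u, hu⟩ := h.2 e
  rw [inner_V_eq h hu hu, Complex.sub_im, Θ.biExtension.apply_self_im, inner_self_ofReal,
    Complex.im_mul_ofReal, Complex.conj_im]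
  have := mul_nonneg hz.le (sq_nonneg ‖HPlus.incl Θ.A u‖)
  linarith

theorem re_rePart_apply_self (f : HPlus Θ.A) : (rePart Θ.main f f).re = (Θ.main f f).re := by
  rw [rePart, smul_apply, smul_apply, add_apply, add_apply, adj_apply, Complex.add_conj]
  simp

theorem isAccretive_iff :
    IsAccretive Θ.main ↔ ∀ f, 0 ≤ (rePart Θ.main f f).re := by
  simp only [IsAccretive, re_rePart_apply_self]

end RiggedCanonicalSystem

/-! ### Accretive implies Stieltjes. -/

namespace RiggedCanonicalSystem

open RiggedSystem

variable {H E : Type*}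
  [NormedAddCommGroup H] [InnerProductSpace ℂ H] [CompleteSpace H]
  [NormedAddCommGroup E] [InnerProductSpace ℂ E] [FiniteDimensional ℂ E]
  {Θ : RiggedCanonicalSystem H E}

theorem shifted_neg_one_apply (f g : HPlus Θ.A) :
    Θ.shifted (-1) f g = rePart Θ.main f g + ⟪HPlus.incl Θ.A g, HPlus.incl Θ.A f⟫_ℂ := by
  rw [Θ.shifted_apply, sub_apply, smul_apply, HMinus.ofH_apply, neg_one_smul, sub_neg_eq_add]

theorem conj_shifted_neg_one_apply (f g : HPlus Θ.A) :
    conj (Θ.shifted (-1) g f) = Θ.shifted (-1) f g := by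
  rw [shifted_neg_one_apply, shifted_neg_one_apply, map_add, Θ.biExtension.conj_apply,
    inner_conj_symm]

theorem shifted_neg_one_self_re (f : HPlus Θ.A) :
    (Θ.shifted (-1) f f).re = (rePart Θ.main f f).re + ‖HPlus.incl Θ.A f‖ ^ 2 := by
  rw [shifted_neg_one_apply, Complex.add_re, inner_self_ofReal, Complex.ofReal_re]

/-- The Cauchy-Schwarz inequality for the form of `Re 𝔸 + I`. -/
theorem norm_shifted_neg_one_sq_le (hacc : ∀ f, 0 ≤ (rePart Θ.main f f).re) (f g : HPlus Θ.A) :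
    ‖Θ.shifted (-1) f g‖ ^ 2 ≤ (Θ.shifted (-1) f f).re * (Θ.shifted (-1) g g).re := by
  let c : PreInnerProductSpace.Core ℂ (HPlus Θ.A) :=
    -- The arguments are swapped since `inner` is conjugate-linear in the first one.
    { inner := fun f g => Θ.shifted (-1) g f
      conj_inner_symm := fun f g => conj_shifted_neg_one_apply g f
      re_inner_nonneg := fun f => by
        change 0 ≤ (Θ.shifted (-1) f f).re
        rw [shifted_neg_one_self_re]
        exact add_nonneg (hacc f) (sq_nonneg _)
      add_left := fun f g h => by simp
      smul_left := fun f g r => by simp }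
  have h := @InnerProductSpace.Core.inner_mul_inner_self_le ℂ (HPlus Θ.A) _ _ _ c f g
  have h1 : ‖Θ.shifted (-1) g f‖ * ‖Θ.shifted (-1) f g‖ ≤
    (Θ.shifted (-1) f f).re * (Θ.shifted (-1) g g).re := h
  rwa [← conj_shifted_neg_one_apply g f, RCLike.norm_conj, ← sq] at h1

theorem exists_isResolvent_neg_one (hacc : ∀ f, 0 ≤ (rePart Θ.main f f).re) :
    ∃ r, Θ.IsResolvent (-1) r :=
  Θ.biExtension.exists_resolvent Θ.dense_A Θ.symmetric_A one_pos
    (fun _ hf => norm_le_of_accretive hacc hf) fun f hf => by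
      rw [map_neg, map_one]
      exact norm_le_of_accretive hacc hf

section Resolvent

variable {r : H →L[ℂ] HPlus Θ.A}

theorem IsResolvent.inner_incl (hr : Θ.IsResolvent (-1) r) (h : H) (f : HPlus Θ.A) :
    ⟪HPlus.incl Θ.A f, h⟫_ℂ = Θ.shifted (-1) (r h) f := by
  rw [hr.shifted_apply, HMinus.ofH_apply]

theorem IsResolvent.isSelfAdjoint (hr : Θ.IsResolvent (-1) r) :
    IsSelfAdjoint ((HPlus.inclL Θ.A).comp r) := by
  rw [ContinuousLinearMap.isSelfAdjoint_iff_isSymmetric]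
  intro h k
  change ⟪HPlus.incl Θ.A (r h), k⟫_ℂ = ⟪h, HPlus.incl Θ.A (r k)⟫_ℂ
  rw [← inner_conj_symm h, hr.inner_incl, hr.inner_incl, conj_shifted_neg_one_apply]

theorem IsResolvent.norm_sq_le (hr : Θ.IsResolvent (-1) r)
    (hacc : ∀ f, 0 ≤ (rePart Θ.main f f).re) (h : H) :
    ‖HPlus.incl Θ.A (r h)‖ ^ 2 ≤ (⟪HPlus.incl Θ.A (r h), h⟫_ℂ).re := by
  rw [hr.inner_incl, shifted_neg_one_self_re]
  linarith [hacc (r h)]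

/-- Both bounds come from `‖C h‖² ≤ Re (C h, h)`: it gives `C ≥ 0`, and `‖C‖ ≤ 1` by Cauchy-Schwarz.
-/
theorem IsResolvent.spectrum_subset (hr : Θ.IsResolvent (-1) r)
    (hacc : ∀ f, 0 ≤ (rePart Θ.main f f).re) :
    spectrum ℝ ((HPlus.inclL Θ.A).comp r) ⊆ Icc 0 1 := by
  intro s hs
  constructor
  · refine spectrum_nonneg_of_nonneg ?_ hs
    rw [ContinuousLinearMap.nonneg_iff_isPositive, ContinuousLinearMap.isPositive_def]
    refine ⟨hr.isSelfAdjoint.isSymmetric, fun h => ?_⟩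
    exact (sq_nonneg _).trans (hr.norm_sq_le hacc h)
  · have h1 : ‖(HPlus.inclL Θ.A).comp r‖ ≤ 1 := by
      refine ContinuousLinearMap.opNorm_le_bound _ zero_le_one fun h => ?_
      have h2 := hr.norm_sq_le hacc h
      have h3 : (⟪HPlus.incl Θ.A (r h), h⟫_ℂ).re ≤ ‖HPlus.incl Θ.A (r h)‖ * ‖h‖ :=
        (Complex.re_le_norm _).trans (norm_inner_le_norm _ _)
      change ‖HPlus.incl Θ.A (r h)‖ ≤ _
      by_contra! h4
      nlinarith [norm_nonneg h]
    have h2 := spectrum.norm_le_norm_mul_of_mem hs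
    have h3 : ‖(1 : H →L[ℂ] H)‖ ≤ 1 := ContinuousLinearMap.norm_id_le
    calc s ≤ ‖s‖ := le_abs_self s
      _ ≤ _ := h2
      _ ≤ 1 * 1 := by gcongr
      _ = 1 := one_mul 1

/-- The resolvent identity between the points `z` and `-1`. -/
theorem IsResolvent.eq_add (hr : Θ.IsResolvent (-1) r)
    (hinj : Function.Injective (Θ.shifted (-1))) {z : ℂ} {φ : HMinus Θ.A} {u v : HPlus Θ.A}
    (hu : Θ.shifted (-1) u = φ) (hv : Θ.shifted z v = φ) :
    v = u + (z + 1) • r (HPlus.incl Θ.A v) := by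
  refine hinj ?_
  rw [map_add, map_smul, hr.shifted_apply, hu, ← hv, Θ.shifted_apply, Θ.shifted_apply]
  module

end Resolvent

theorem isStieltjes_of_accretive
    (hK : ∀ e : E, ∃ (f : HPlus Θ.A) (h : H),
      Θ.K e = imPart Θ.main f + HMinus.ofH Θ.A h)
    (hacc : ∀ f, 0 ≤ (rePart Θ.main f f).re) : IsStieltjes Θ.V := by
  have hcE : CompleteSpace E := FiniteDimensional.complete ℂ E
  obtain ⟨r, hr⟩ := exists_isResolvent_neg_one hacc
  have hdef : Θ.IsDefinedAt (-1) :=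
    hr.isDefinedAt hK one_pos fun _ hf => norm_le_of_accretive hacc hf
  have hdefz : ∀ z : ℂ, z.im ≠ 0 → Θ.IsDefinedAt z := fun z hz => isDefinedAt_of_im hz hK
  set C : H →L[ℂ] H := (HPlus.inclL Θ.A).comp r
  have hC : IsSelfAdjoint C := hr.isSelfAdjoint
  let F : E →L[ℂ] H := (HPlus.inclL Θ.A).comp (LinearMap.toContinuousLinearMap (Θ.invK hdef))
  have hF : ∀ e, F e = HPlus.incl Θ.A (Θ.invK hdef e) := fun e => rfl
  have hu := Θ.shifted_invK hdef
  have hV₀ : ∀ e, ⟪e, Θ.V (-1) e⟫_ℂ = Θ.shifted (-1) (Θ.invK hdef e) (Θ.invK hdef e) := fun e => by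
    rw [inner_V_eq hdef (hu e) (hu e), shifted_neg_one_apply]
    simp
  have hVz : ∀ z : ℂ, z.im ≠ 0 → ∀ e, ∃ g, g - (z + 1) • C g = F e ∧
      ∀ e', ⟪e', Θ.V z e⟫_ℂ = ⟪e', Θ.V (-1) e⟫_ℂ + (z + 1) * ⟪F e', g⟫_ℂ := fun z hz e => by
    obtain ⟨v, hv⟩ := (hdefz z hz).2 e
    have h1 := hr.eq_add hdef.1 (hu e) hv
    refine ⟨HPlus.incl Θ.A v, ?_, fun e' => ?_⟩
    · rw [sub_eq_iff_eq_add]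
      exact congrArg (HPlus.incl Θ.A) h1
    · rw [inner_V_apply (hdefz z hz) hv, inner_V_apply hdef (hu e), ← hu e',
        conj_shifted_neg_one_apply, conj_shifted_neg_one_apply, hF, hr.inner_incl]
      conv_lhs => rw [h1]
      rw [map_add, map_smul, add_apply, smul_apply, smul_eq_mul]
  refine ⟨⟨?_, fun z hz => V_symm (hdefz z hz) (hdefz _ (by simpa using hz)),
    fun z hz => V_im_nonneg (hdefz z hz.ne') hz⟩, ?_⟩
  · have hunit : ∀ z : ℂ, z.im ≠ 0 → IsUnit (1 - (z + 1) • C) := fun z hz => by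
      have hζ : (z + 1).im ≠ 0 := by simpa using hz
      rw [ContinuousLinearMap.isUnit_iff_bijective]
      refine ⟨(injective_iff_map_eq_zero _).2 fun g hg => sub_smul_apply_injective hC hζ hg,
        fun x => ?_⟩
      obtain ⟨ν, -, -, hν⟩ := exists_spectral_measure hC x
      obtain ⟨g, hg, -⟩ := exists_resolvent_integral hC hν hζ
      exact ⟨g, hg⟩
    -- The explicit formula makes `V_Θ` holomorphic, inversion being differentiable at units.
    have hform : ∀ z ∈ {z : ℂ | z.im ≠ 0}, Θ.V z = Θ.V (-1) + (z + 1) •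
        (ContinuousLinearMap.adjoint F).comp ((Ring.inverse (1 - (z + 1) • C)).comp F) := by
      intro z hz
      refine ContinuousLinearMap.ext fun e => ext_inner_left ℂ fun e' => ?_
      obtain ⟨g, hg, hg'⟩ := hVz z hz e
      have h1 : Ring.inverse (1 - (z + 1) • C) (F e) = g := by
        rw [← hg]
        exact congrArg (fun L : H →L[ℂ] H => L g) (Ring.inverse_mul_cancel _ (hunit z hz))
      rw [hg', add_apply, inner_add_right, smul_apply, inner_smul_right, ← h1]
      congr 2
      exact (ContinuousLinearMap.adjoint_inner_right F e' _).symm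
    refine DifferentiableOn.congr (fun z hz => DifferentiableAt.differentiableWithinAt ?_) hform
    have h1 : DifferentiableAt ℂ (fun z : ℂ => 1 - (z + 1) • C) z := by fun_prop
    have h2 : DifferentiableAt ℂ (fun z : ℂ => Ring.inverse (1 - (z + 1) • C)) z :=
      DifferentiableAt.comp (g := Ring.inverse) z (differentiableAt_inverse (hunit z hz)) h1
    fun_prop
  · obtain ⟨γ, G, hG, hγ, hint, hrep⟩ := exists_stieltjes_representation hC
      (hr.spectrum_subset hacc) F (Θ.V (-1))
      (fun e => by
        rw [hV₀]
        exact Complex.conj_eq_iff_im.1 (conj_shifted_neg_one_apply _ _))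
      (fun e => by
        rw [hV₀, shifted_neg_one_self_re]
        exact add_nonneg (hacc _) (sq_nonneg _))
      -- Cauchy-Schwarz at `r k` and `(Re 𝔸 + I)⁻¹ K e`, where the form of `Re 𝔸 + I` takes the
      -- values `(C k, k)` and `(V(-1) e, e)`.
      fun k e => by
        rw [hV₀, ← inner_conj_symm k (F e), RCLike.norm_conj, hF, hr.inner_incl]
        refine (norm_shifted_neg_one_sq_le hacc _ _).trans_eq ?_
        congr 1
        rw [← inner_conj_symm k (C k), Complex.conj_re]
        exact congrArg Complex.re (hr.inner_incl k (r k)).symm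
    refine ⟨γ, G, hG, hγ, hint, fun z hz e => ?_⟩
    obtain ⟨g, hg, hg'⟩ := hVz z hz e
    rw [hg' e]
    exact hrep z hz e g hg

end RiggedCanonicalSystem

/-! ### Stieltjes implies accretive: defect vectors with indices free of conjugate pairs. -/

/-- A set of non-real points that is dense in `ℂ \ ℝ` and contains no two conjugate points. -/
def conjFreeSet : Set ℂ :=
  {z | (0 < z.im ∧ ¬Irrational z.re) ∨ (z.im < 0 ∧ Irrational z.re)}

theorem im_ne_zero_of_mem_conjFreeSet {z : ℂ} (hz : z ∈ conjFreeSet) : z.im ≠ 0 := by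
  rcases hz with ⟨h, -⟩ | ⟨h, -⟩
  exacts [h.ne', h.ne]

theorem ne_conj_of_mem_conjFreeSet {z w : ℂ} (hz : z ∈ conjFreeSet) (hw : w ∈ conjFreeSet) :
    z ≠ conj w := by
  rintro rfl
  rcases hz with ⟨h, h'⟩ | ⟨h, h'⟩ <;> rcases hw with ⟨k, k'⟩ | ⟨k, k'⟩ <;>
    simp only [Complex.conj_im, Complex.conj_re] at h h'
  · linarith
  · exact h' k'
  · exact k' h'
  · linarith

theorem neg_I_notMem_conjFreeSet : -Complex.I ∉ conjFreeSet := by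
  rintro (⟨h, -⟩ | ⟨-, h⟩)
  · norm_num at h
  · rw [Complex.neg_re, Complex.I_re, neg_zero] at h
    exact not_irrational_zero h

theorem mem_closure_conjFreeSet {w : ℂ} (hw : w.im ≠ 0) : w ∈ closure conjFreeSet := by
  have key : ∀ S : Set ℝ, Dense S → (∀ x ∈ S, (⟨x, w.im⟩ : ℂ) ∈ conjFreeSet) →
      w ∈ closure conjFreeSet := fun S hS h => by
    have hc : Continuous fun x : ℝ => (⟨x, w.im⟩ : ℂ) := by
      have : (fun x : ℝ => (⟨x, w.im⟩ : ℂ)) = fun x : ℝ => (x : ℂ) + w.im * Complex.I :=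
        funext fun x => Complex.ext (by simp) (by simp)
      rw [this]
      fun_prop
    exact map_mem_closure hc (hS w.re) h
  rcases lt_or_gt_of_ne hw with h | h
  · exact key _ dense_irrational fun x hx => Or.inr ⟨h, hx⟩
  · refine key _ Rat.denseRange_cast fun x hx => Or.inl ⟨h, ?_⟩
    obtain ⟨q, rfl⟩ := hx
    exact q.not_irrational

namespace RiggedCanonicalSystem

open RiggedSystem

variable {H E : Type*}
  [NormedAddCommGroup H] [InnerProductSpace ℂ H] [CompleteSpace H]
  [NormedAddCommGroup E] [InnerProductSpace ℂ E] [FiniteDimensional ℂ E]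
  {Θ : RiggedCanonicalSystem H E}

/-- On `𝔑_z` the term `A* - z` vanishes, so `Re 𝔸 - z` acts as `boundaryPart`, whose range is that
of `Im 𝔸 = K J K*`. -/
theorem exists_shifted_eq_of_defect {z : ℂ} {f : HPlus Θ.A}
    (hf : HPlus.star Θ.A f = z • HPlus.incl Θ.A f) : ∃ e, Θ.shifted z f = Θ.K e := by
  have h1 : boundaryPart Θ.main f ∈ LinearMap.range (imPart Θ.main).toLinearMap := by
    rw [← Θ.range_boundaryPart_eq]
    exact ⟨f, rfl⟩
  obtain ⟨f', hf'⟩ := h1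
  refine ⟨Θ.J (channelAdj Θ.K f'), ?_⟩
  rw [Θ.shifted_eq_boundaryPart, hf, sub_self, map_zero, add_zero, ← hf', Θ.imPart_main]
  rfl

theorem rePart_apply_eq_kernel {z w : ℂ} (hz : Θ.IsDefinedAt z) (hw : Θ.IsDefinedAt w)
    (hzw : z ≠ conj w) {e e' : E} {u v : HPlus Θ.A}
    (hu : Θ.shifted z u = Θ.K e) (hv : Θ.shifted w v = Θ.K e') :
    rePart Θ.main u v =
      (z * ⟪e', Θ.V z e⟫_ℂ - conj w * ⟪Θ.V w e', e⟫_ℂ) / (z - conj w) := by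
  rw [eq_div_iff (sub_ne_zero.2 hzw), inner_V_eq hz hu hv, V_inner_eq hw hu hv]
  ring

variable (Θ) in
/-- The span in `H₊` of the defect subspaces with indices in a set. -/
noncomputable def defectSpan (Z : Set ℂ) : Submodule ℂ (HPlus Θ.A) :=
  Submodule.span ℂ {f | ∃ z ∈ Z, HPlus.star Θ.A f = z • HPlus.incl Θ.A f}

/-- The form at a sum of defect vectors expands into the kernel sum; `conjFreeSet` keeps every
denominator `z k - conj (z l)` non-zero. -/
theorem rePart_nonneg_of_mem_defectSpan (hdef : ∀ z : ℂ, z.im ≠ 0 → Θ.IsDefinedAt z)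
    (hV : KernelNonneg Θ.V) {f : HPlus Θ.A} (hf : f ∈ Θ.defectSpan conjFreeSet) :
    0 ≤ (rePart Θ.main f f).re := by
  obtain ⟨n, c, g, rfl⟩ := Submodule.mem_span_set'.1 hf
  choose z hzZ hz using fun i => (g i).2
  have hz' : ∀ i, HPlus.star Θ.A (c i • (g i : HPlus Θ.A)) =
      z i • HPlus.incl Θ.A (c i • (g i : HPlus Θ.A)) := fun i => by
    rw [map_smul, map_smul, hz i, smul_comm]
  choose e he using fun i => exists_shifted_eq_of_defect (hz' i)
  have him := fun i => im_ne_zero_of_mem_conjFreeSet (hzZ i)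
  have hne := fun k l => ne_conj_of_mem_conjFreeSet (hzZ k) (hzZ l)
  refine (hV n z e him hne).trans_eq ?_
  congr 1
  rw [map_sum (rePart Θ.main), sum_apply]
  refine Finset.sum_congr rfl fun k _ => ?_
  rw [map_sum]
  refine Finset.sum_congr rfl fun l _ => ?_
  exact (rePart_apply_eq_kernel (hdef _ (him k)) (hdef _ (him l)) (hne k l) (he k) (he l)).symm

/-- Defect vectors depend continuously on the index. -/
theorem mem_closure_defectSpan {w : ℂ} (hw : w.im ≠ 0) {f : HPlus Θ.A}
    (hf : HPlus.star Θ.A f = w • HPlus.incl Θ.A f) :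
    f ∈ (Θ.defectSpan conjFreeSet).topologicalClosure := by
  choose r hr using fun z : conjFreeSet =>
    exists_isResolvent (Θ := Θ) (im_ne_zero_of_mem_conjFreeSet z.2)
  -- `1 + (z - w) r_z` carries `𝔑_w` into `𝔑_z`, and `r_z` stays bounded as `z → w`.
  let g : conjFreeSet → HPlus Θ.A := fun z => f + ((z : ℂ) - w) • r z (HPlus.incl Θ.A f)
  have hg : ∀ z, g z ∈ Θ.defectSpan conjFreeSet := fun z => by
    refine Submodule.subset_span ⟨z, z.2, ?_⟩
    have h1 : HPlus.star Θ.A (r z (HPlus.incl Θ.A f)) = HPlus.incl Θ.A f +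
        (z : ℂ) • HPlus.incl Θ.A (r z (HPlus.incl Θ.A f)) := sub_eq_iff_eq_add.1 (hr z _).2
    simp only [g, map_add, map_smul, hf, h1]
    module
  have hbot : (comap (Subtype.val : conjFreeSet → ℂ) (𝓝 w)).NeBot :=
    mem_closure_iff_comap_neBot.1 (mem_closure_conjFreeSet hw)
  have hval : Tendsto (Subtype.val : conjFreeSet → ℂ) (comap Subtype.val (𝓝 w)) (𝓝 w) :=
    tendsto_comap
  have hbound : ∀ z : conjFreeSet, ‖g z - f‖ ≤ ‖(z : ℂ) - w‖ *
      ((1 + ‖(z : ℂ)‖) * (‖HPlus.incl Θ.A f‖ / |(z : ℂ).im|) + ‖HPlus.incl Θ.A f‖) := fun z => by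
    set k := r z (HPlus.incl Θ.A f)
    have h1 := Θ.biExtension.abs_im_mul_norm_le (hr z (HPlus.incl Θ.A f)).1 z
    rw [(hr z (HPlus.incl Θ.A f)).2] at h1
    have h2 : ‖HPlus.incl Θ.A k‖ ≤ ‖HPlus.incl Θ.A f‖ / |(z : ℂ).im| := by
      rw [le_div_iff₀ (abs_pos.2 (im_ne_zero_of_mem_conjFreeSet z.2)), mul_comm]
      exact h1
    have h3 : ‖HPlus.star Θ.A k‖ ≤ ‖HPlus.incl Θ.A f‖ + ‖(z : ℂ)‖ * ‖HPlus.incl Θ.A k‖ := by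
      rw [← norm_smul, sub_eq_iff_eq_add.1 (hr z (HPlus.incl Θ.A f)).2]
      exact norm_add_le _ _
    have h4 := HPlus.norm_le k
    rw [show g z - f = ((z : ℂ) - w) • k from add_sub_cancel_left _ _, norm_smul]
    gcongr
    calc ‖k‖ ≤ _ := h4
      _ ≤ (1 + ‖(z : ℂ)‖) * ‖HPlus.incl Θ.A k‖ + ‖HPlus.incl Θ.A f‖ := by linarith
      _ ≤ _ := by gcongr
  have hlim : Tendsto g (comap Subtype.val (𝓝 w)) (𝓝 f) := by
    refine tendsto_iff_norm_sub_tendsto_zero.2 (squeeze_zero (fun _ => norm_nonneg _) hbound ?_)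
    have h1 := ((hval.sub_const w).norm).mul ((((hval.norm).const_add 1).mul
      ((tendsto_const_nhds (x := ‖HPlus.incl Θ.A f‖)).div
        ((Complex.continuous_im.tendsto w).comp hval).abs (abs_ne_zero.2 hw))).add_const
          ‖HPlus.incl Θ.A f‖)
    rwa [sub_self, norm_zero, zero_mul] at h1
  exact mem_closure_of_tendsto hlim (Eventually.of_forall hg)

/-- Primeness gives density in `H` only. It is lifted to `H₊` by the resolvent `r` at `-i`, which
maps `H` into the closed span `L`; then `H₊` is the sum of `Ran r` and `𝔑_{-i}`, both inside `L`. -/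
theorem defectSpan_closure_eq_top (hprime : Θ.IsPrime) :
    (Θ.defectSpan conjFreeSet).topologicalClosure = ⊤ := by
  set L := (Θ.defectSpan conjFreeSet).topologicalClosure
  have hLcl : IsClosed (L : Set (HPlus Θ.A)) := Submodule.isClosed_topologicalClosure _
  have hI : (-Complex.I).im ≠ 0 := by norm_num
  obtain ⟨r, hr⟩ := exists_isResolvent (Θ := Θ) hI
  have hr' : ∀ h, HPlus.star Θ.A (r h) = h + (-Complex.I) • HPlus.incl Θ.A (r h) := fun h =>
    sub_eq_iff_eq_add.1 (hr h).2
  have h1 : L ≤ L.comap (r.comp (HPlus.inclL Θ.A)).toLinearMap := by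
    refine Submodule.topologicalClosure_minimal _ (Submodule.span_le.2 ?_)
      (hLcl.preimage (r.comp (HPlus.inclL Θ.A)).continuous)
    rintro f ⟨w, hw, hf⟩
    have hwI : w - (-Complex.I) ≠ 0 := sub_ne_zero.2 fun h => neg_I_notMem_conjFreeSet (h ▸ hw)
    change r (HPlus.incl Θ.A f) ∈ L
    set k := r (HPlus.incl Θ.A f) with hk
    -- For `f ∈ 𝔑_w` and `k = r f` this vector lies in `𝔑_{-i}`. Solving for `k` needs `w ≠ -i`,
    -- true as `-i ∉ conjFreeSet`.
    have hq : (w - (-Complex.I)) • k - f ∈ L := by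
      refine mem_closure_defectSpan hI ?_
      rw [map_sub, map_sub, map_smul, map_smul, hf, hk, hr']
      module
    have h2 := L.smul_mem (w - (-Complex.I))⁻¹
      (L.add_mem hq (mem_closure_defectSpan (im_ne_zero_of_mem_conjFreeSet hw) hf))
    rwa [sub_add_cancel, smul_smul, inv_mul_cancel₀ hwI, one_smul] at h2
  have h2 : ∀ h, r h ∈ L := by
    have h3 : (⨆ z ∈ {z : ℂ | z.im ≠ 0 ∧ IsRegularPoint Θ.T z}, defect Θ.A z).topologicalClosure ≤
        L.comap r.toLinearMap := by
      refine Submodule.topologicalClosure_minimal _ (iSup₂_le fun z hz => ?_)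
        (hLcl.preimage r.continuous)
      rintro _ ⟨f, hf, rfl⟩
      exact h1 (mem_closure_defectSpan hz.1 (sub_eq_zero.1 (LinearMap.mem_ker.1 hf)))
    rw [hprime] at h3
    exact fun h => h3 Submodule.mem_top
  rw [Submodule.eq_top_iff']
  intro f
  obtain ⟨h, hh⟩ : ∃ h, HPlus.star Θ.A f = h + (-Complex.I) • HPlus.incl Θ.A f :=
    ⟨_, (sub_add_cancel _ _).symm⟩
  have h3 : f - r h ∈ L := by
    refine mem_closure_defectSpan hI ?_
    rw [map_sub, map_sub, hr', hh]
    module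
  simpa using L.add_mem h3 (h2 h)

theorem accretive_of_kernelNonneg (hprime : Θ.IsPrime)
    (hdef : ∀ z : ℂ, z.im ≠ 0 → Θ.IsDefinedAt z) (hV : KernelNonneg Θ.V) (f : HPlus Θ.A) :
    0 ≤ (rePart Θ.main f f).re := by
  have hc : Continuous fun f : HPlus Θ.A => rePart Θ.main f f := by
    refine continuous_iff_continuousAt.2 fun f => tendsto_iff_norm_sub_tendsto_zero.2 ?_
    have h1 : Continuous fun g : HPlus Θ.A => ‖rePart Θ.main‖ * ‖g - f‖ * (‖g‖ + ‖f‖) := by fun_prop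
    refine squeeze_zero (fun _ => norm_nonneg _) (fun g => ?_)
      (by simpa using h1.tendsto f)
    have h2 : rePart Θ.main g g - rePart Θ.main f f =
        rePart Θ.main (g - f) g + rePart Θ.main f (g - f) := by
      simp only [map_sub, sub_apply]
      ring
    have h3 := (rePart Θ.main).le_opNorm₂ (g - f) g
    have h4 := (rePart Θ.main).le_opNorm₂ f (g - f)
    rw [h2]
    refine (norm_add_le _ _).trans ((add_le_add h3 h4).trans_eq ?_)
    ring
  have hcl : IsClosed {f : HPlus Θ.A | 0 ≤ (rePart Θ.main f f).re} :=
    isClosed_le continuous_const (Complex.continuous_re.comp hc)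
  have h1 : closure (Θ.defectSpan conjFreeSet : Set (HPlus Θ.A)) ⊆ _ := closure_minimal
    (fun g hg => rePart_nonneg_of_mem_defectSpan hdef hV hg) hcl
  have h2 : f ∈ (Θ.defectSpan conjFreeSet).topologicalClosure := by
    rw [defectSpan_closure_eq_top hprime]
    exact Submodule.mem_top
  exact h1 h2

end RiggedCanonicalSystem

theorem theorem4p2 {H E : Type*}
    [NormedAddCommGroup H] [InnerProductSpace ℂ H] [CompleteSpace H]
    [NormedAddCommGroup E] [InnerProductSpace ℂ E] [FiniteDimensional ℂ E]
    (Θ : RiggedCanonicalSystem H E) (hprime : Θ.IsPrime)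
    (hK : ∀ e : E, ∃ (f : RiggedSystem.HPlus Θ.A) (h : H),
      Θ.K e = RiggedSystem.imPart Θ.main f + RiggedSystem.HMinus.ofH Θ.A h) :
    (∀ z : ℂ, z.im ≠ 0 → Θ.IsDefinedAt z) ∧
      (IsStieltjes Θ.V ↔ RiggedSystem.IsAccretive Θ.main) := by
  have hdef : ∀ z : ℂ, z.im ≠ 0 → Θ.IsDefinedAt z := fun z hz =>
    RiggedCanonicalSystem.isDefinedAt_of_im hz hK
  rw [RiggedCanonicalSystem.isAccretive_iff]
  exact ⟨hdef, fun h =>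
    RiggedCanonicalSystem.accretive_of_kernelNonneg hprime hdef h.kernelNonneg,
    RiggedCanonicalSystem.isStieltjes_of_accretive hK⟩
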